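/- Let $k$ be a $\mathfrak p$-adic field (a non-archimedean local field) with ring of integers $\mathfrak o$, prime element $\pi$ and residue field with $q$ elements, $q$ odd. Let $D$ be the division quaternion algebra over $k$ with standard basis $1,\varepsilon,\varPi,\varepsilon\varPi$, where $\varepsilon^2=u$ for some $u\in\mathfrak o$ whose residue class is not a square (so $k(\varepsilon)/k$ is the unramified quadratic extension), $\varPi^2=\pi$ and $\varepsilon\varPi=-\varPi\varepsilon$. Let $\mathcal O=\mathfrak o+\mathfrak o\varepsilon+\mathfrak o\varPi+\mathfrak o\varepsilon\varPi$ be its ring of integers, $x\mapsto x^*$ the standard involution, $\mathrm{Trd}(x)=x+x^*$, and $(A^*)_{ij}=(A_{ji})^*$ for matrices $A$ over $D$. Put $$V_n=\{x\in M_n(D): x^*=x\},\quad V_n(\mathcal O)=V_n\cap M_n(\mathcal O),\quad X_n=V_n\cap GL_n(D),$$ $$\langle A,B\rangle=\sum_{i}A_{ii}B_{ii}+\sum_{i<j}\mathrm{Trd}(A_{ij}B_{ji})\in k\quad(A,B\in V_n),\qquad A[v]=v^*Av\quad(A\in V_m,\ v\in M_{mn}(D)).$$ Let $\psi$ be an additive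 character of $k$ of conductor $\mathfrak o$ (that is, $\mathfrak o$ is the largest fractional ideal on which $\psi$ is trivial), and let $dv$, $dx$ be the Haar measures on $M_{mn}(D)$ and $V_n$ normalized by $\int_{M_{mn}(\mathcal O)}dv=1$, $\int_{V_n(\mathcal O)}dx=1$. For $A\in V_m$, $C\in V_n$ the Gauss sum is $$\mathcal G(A,C)=\int_{M_{mn}(\mathcal O)}\psi(\langle A[v],C\rangle)\,dv,$$ and the Fourier transform of a function $f$ on $V_n$ is $\mathcal F(f)(y)=\int_{V_n}f(x)\,\psi(-\langle x,y\rangle)\,dx$. For integral $A\in X_m$ and $B\in X_n$ the local density is $$\mu(B,A)=\lim_{\ell\to\infty}\frac{\#\{\bar v\in M_{mn}(\mathcal O/\pi^\ell\mathcal O): A[v]-B\in M_n(\pi^\ell\mathcal O)\}}{q^{\ell n(4m-2n+1)}},$$ and it is extended to all $A\in X_m$, $B\in X_n$ by $\mu(\pi^eB,\pi^eA)=q^{en(2n-1)}\mu(B,A)$. **Proposition 2.4.** Let $A\in X_m$ with $m\ge 8n-1$. Then for every $T\in V_n$ the integral defining the Fourier transform $\mathcal F(\mathcal G(A,\cdot))(T)$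 converges absolutely. For every $B\in X_n$ the local density $\mu(B,A)$ is well defined (for every $e\ge 0$ for which $\pi^eA$ and $\pi^eB$ are integral, the limit defining $\mu(\pi^eB,\pi^eA)$ exists, and $q^{-en(2n-1)}\mu(\pi^eB,\pi^eA)$ does not depend on $e$), and $$\mathcal F(\mathcal G(A,\cdot))(B)=q^{n(n-1)}\,\mu(B,A).$$ -/

import Mathlib

open MeasureTheory Filter Topology ValuativeRel
open scoped Matrix Pointwise

namespace QuatHerm

section

variable {k : Type*} [Field k] [ValuativeRel k]

/-- The quaternion algebra over `k` with standard basis `1, ε, Π, εΠ`, where `ε ^ 2 = u`,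
`Π ^ 2 = π` and `ε Π = - Π ε`; here `ε = ⟨0, 1, 0, 0⟩` and `Π = ⟨0, 0, 1, 0⟩`.
When `u` is not a square in the residue field (so that `k(ε) / k` is unramified quadratic) and `π`
is a prime element, this is the division quaternion algebra over the local field `k`.
Its `star` is the standard involution `a + bε + cΠ + dεΠ ↦ a - bε - cΠ - dεΠ`. -/
abbrev Quat (u π : 𝒪[k]) : Type _ := QuaternionAlgebra k (u : k) 0 (π : k)

/-- The topology of `D` as a four dimensional vector space over `k`. -/
instance [TopologicalSpace k] (u π : 𝒪[k]) : TopologicalSpace (Quat u π) :=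
  TopologicalSpace.induced (QuaternionAlgebra.equivProd (u : k) 0 (π : k)) inferInstance

/-- Matrices over `D` carry the Borel sets of the (entrywise) topology. -/
instance [TopologicalSpace k] (u π : 𝒪[k]) (m n : ℕ) :
    MeasurableSpace (Matrix (Fin m) (Fin n) (Quat u π)) := borel _

instance [TopologicalSpace k] (u π : 𝒪[k]) (m n : ℕ) :
    BorelSpace (Matrix (Fin m) (Fin n) (Quat u π)) := ⟨rfl⟩

/-- The ring of integers of `D`: the span of `1, ε, Π, εΠ` over the ring of integers of `k`. -/
def integers (u π : 𝒪[k]) : Subring (Quat u π) where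
  carrier := {x | x.re ∈ 𝒪[k] ∧ x.imI ∈ 𝒪[k] ∧ x.imJ ∈ 𝒪[k] ∧ x.imK ∈ 𝒪[k]}
  zero_mem' := ⟨zero_mem _, zero_mem _, zero_mem _, zero_mem _⟩
  one_mem' := ⟨one_mem _, zero_mem _, zero_mem _, zero_mem _⟩
  add_mem' := fun ha hb => ⟨add_mem ha.1 hb.1, add_mem ha.2.1 hb.2.1,
    add_mem ha.2.2.1 hb.2.2.1, add_mem ha.2.2.2 hb.2.2.2⟩
  neg_mem' := fun ha => ⟨neg_mem ha.1, neg_mem ha.2.1, neg_mem ha.2.2.1, neg_mem ha.2.2.2⟩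
  mul_mem' := by
    rintro ⟨a₁, a₂, a₃, a₄⟩ ⟨b₁, b₂, b₃, b₄⟩ ⟨h₁, h₂, h₃, h₄⟩ ⟨g₁, g₂, g₃, g₄⟩
    have hu := u.2
    have hp := π.2
    simp only [Set.mem_ofPred_eq, QuaternionAlgebra.mk_mul_mk, zero_mul, add_zero]
    dsimp only at h₁ h₂ h₃ h₄ g₁ g₂ g₃ g₄
    refine ⟨?_, ?_, ?_, ?_⟩ <;>
      repeat' first | assumption | apply add_mem | apply sub_mem | apply mul_mem

/-- `M_{mn}(O)`: the matrices with entries in the ring of integers of `D`. -/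
def integralMatrices (u π : 𝒪[k]) (m n : ℕ) : AddSubgroup (Matrix (Fin m) (Fin n) (Quat u π)) where
  carrier := {v | ∀ i j, v i j ∈ integers u π}
  zero_mem' := fun _ _ => zero_mem _
  add_mem' := fun ha hb i j => add_mem (ha i j) (hb i j)
  neg_mem' := fun ha i j => neg_mem (ha i j)

/-- `V_n`: the hermitian matrices `x = x*` of size `n` over `D` (`star` is the conjugate
transpose). -/
abbrev Herm (u π : 𝒪[k]) (n : ℕ) : AddSubgroup (Matrix (Fin n) (Fin n) (Quat u π)) :=
  selfAdjoint (Matrix (Fin n) (Fin n) (Quat u π))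

/-- `V_n(O)`: the hermitian matrices with integral entries. -/
def integralHerm (u π : 𝒪[k]) (n : ℕ) : Set (Herm u π n) :=
  {x | (x : Matrix (Fin n) (Fin n) (Quat u π)) ∈ integralMatrices u π n n}

/-- `X_n`: the invertible hermitian matrices. -/
def nondegHerm (u π : 𝒪[k]) (n : ℕ) : Set (Herm u π n) :=
  {x | IsUnit (x : Matrix (Fin n) (Fin n) (Quat u π))}

/-- The reduced trace `x + x*` of `D`, as an element of `k`. -/
def trd {u π : 𝒪[k]} (x : Quat u π) : k := (x + star x).re

/-- The pairing `⟨A, B⟩ = ∑ A_ii B_ii + ∑_{i < j} Trd (A_ij B_ji)` with values in `k`;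
the diagonal entries of hermitian matrices lie in `k`, so that they equal their real parts. -/
def pairing {u π : 𝒪[k]} {n : ℕ} (A B : Matrix (Fin n) (Fin n) (Quat u π)) : k :=
  ∑ i, (A i i).re * (B i i).re +
    ∑ i, ∑ j ∈ Finset.univ.filter (fun j => i < j), trd (A i j * B j i)

/-- The additive character `ψ` has conductor `𝒪`: the ring of integers of `k` is the largest
fractional ideal on which it is trivial. -/
def HasConductorIntegers (ψ : AddChar k Circle) : Prop :=
  ∀ x : k, (∀ a ∈ 𝒪[k], ψ (a * x) = 1) ↔ x ∈ 𝒪[k]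

/-- The number of elements of the residue field. -/
noncomputable def residueCard (k : Type*) [Field k] [ValuativeRel k] : ℕ := Nat.card 𝓀[k]

/-- The Gauss sum `G(A, C) = ∫_{M_{mn}(O)} ψ(⟨v* A v, C⟩) dv`. -/
noncomputable def gaussSum [TopologicalSpace k] {u π : 𝒪[k]} {m n : ℕ} (ψ : AddChar k Circle)
    (dv : Measure (Matrix (Fin m) (Fin n) (Quat u π))) (A : Herm u π m) (C : Herm u π n) : ℂ :=
  ∫ v in (integralMatrices u π m n : Set (Matrix (Fin m) (Fin n) (Quat u π))),
    (ψ (pairing (vᴴ * (A : Matrix (Fin m) (Fin m) (Quat u π)) * v) C) : ℂ) ∂dv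

/-- The integrand `x ↦ f(x) ψ(-⟨x, y⟩)` of the Fourier transform of `f` at `y`. -/
noncomputable def fourierIntegrand {u π : 𝒪[k]} {n : ℕ} (ψ : AddChar k Circle)
    (f : Herm u π n → ℂ) (y x : Herm u π n) : ℂ :=
  f x * (ψ (-pairing (x : Matrix (Fin n) (Fin n) (Quat u π)) y) : ℂ)

/-- The Fourier transform `F(f)(y) = ∫_{V_n} f(x) ψ(-⟨x, y⟩) dx`. -/
noncomputable def fourierTransform [TopologicalSpace k] {u π : 𝒪[k]} {n : ℕ} (ψ : AddChar k Circle)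
    (dx : Measure (Herm u π n)) (f : Herm u π n → ℂ) (y : Herm u π n) : ℂ :=
  ∫ x, fourierIntegrand ψ f y x ∂dx

/-- For integral `A` and `B`, the number of classes `v` in `M_{mn}(O) / π ^ ℓ M_{mn}(O)` such that
`v* A v - B` has entries in `π ^ ℓ O`. -/
noncomputable def repCount {u π : 𝒪[k]} {m n : ℕ} (B : Matrix (Fin n) (Fin n) (Quat u π))
    (A : Matrix (Fin m) (Fin m) (Quat u π)) (ℓ : ℕ) : ℕ :=
  Nat.card {w : integralMatrices u π m n ⧸
      ((π : k) ^ ℓ • integralMatrices u π m n).addSubgroupOf (integralMatrices u π m n) //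
    ∃ v : integralMatrices u π m n, QuotientAddGroup.mk v = w ∧
      (v : Matrix (Fin m) (Fin n) (Quat u π))ᴴ * A * (v : Matrix (Fin m) (Fin n) (Quat u π)) - B ∈
        (π : k) ^ ℓ • integralMatrices u π n n}

/-- `repCount` divided by `q ^ (ℓ n (4m - 2n + 1))`; the exponent is `ℓ` times the difference of
the dimensions `4mn` of `M_{mn}(D)` and `n (2n - 1)` of `V_n` over `k`. -/
noncomputable def repRatio {u π : 𝒪[k]} {m n : ℕ} (B : Matrix (Fin n) (Fin n) (Quat u π))
    (A : Matrix (Fin m) (Fin m) (Quat u π)) (ℓ : ℕ) : ℝ :=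
  (repCount B A ℓ : ℝ) / (residueCard k : ℝ) ^ ((ℓ : ℤ) * n * (4 * m - 2 * n + 1))

/-- `π ^ e` is a common denominator of `A` and `B`. -/
def IsDenominator {u π : 𝒪[k]} {m n : ℕ} (B : Matrix (Fin n) (Fin n) (Quat u π))
    (A : Matrix (Fin m) (Fin m) (Quat u π)) (e : ℕ) : Prop :=
  (π : k) ^ e • A ∈ integralMatrices u π m m ∧ (π : k) ^ e • B ∈ integralMatrices u π n n

/-- The local density `μ(B, A)`. For integral `A` and `B` it is the limit of `repRatio B A ℓ` as
`ℓ → ∞`; it is extended to all `A`, `B` by `μ(π ^ e B, π ^ e A) = q ^ (e n (2n - 1)) μ(B, A)`,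
here with the least `e` such that `π ^ e A` and `π ^ e B` are integral. -/
noncomputable def localDensity {u π : 𝒪[k]} {m n : ℕ} (B : Matrix (Fin n) (Fin n) (Quat u π))
    (A : Matrix (Fin m) (Fin m) (Quat u π)) : ℝ :=
  let e : ℕ := sInf {e | IsDenominator B A e}
  (residueCard k : ℝ) ^ (-((e : ℤ) * n * (2 * n - 1))) *
    limUnder atTop (repRatio ((π : k) ^ e • B) ((π : k) ^ e • A))

end

end QuatHerm

namespace QuatHerm

/-! ### Coordinate lattices: index, exhaustion, finiteness of images. -/

section Box

variable {k : Type*} [Field k] [ValuativeRel k]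

/-! Absolute convergence comes from Weyl differencing. Writing `|G(A, C)|²` as a double integral and
using that `v ↦ ⟨A[v], C⟩` is quadratic, only those `h` survive for which the polar character of `h`
is trivial on the integral matrices. As `A` is invertible, this forces `h * C'` to be integral for
`C' = π ^ a • C` with `a` depending on `A` only. Such `h` have measure `N ^ (-m)`, where `N` is the
order of the submodule of `D ^ n / O ^ n` generated by the rows of `C'`; this is
`norm_gaussSum_sq_le`. Hence `|G(A, C)| ≤ N ^ (-3n)` as soon as `m ≥ 6n`.

The integral of this bound over `V_n` is a constant times a sum over classes of hermitian matrices.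
It is enlarged to all `n`-tuples of elements of `D ^ n / O ^ n` and estimated by adjoining one
generator at a time (`tsum_invCard_sup_span_le`, `tsum_invCard_span_range_le`).

For the identity, the Fourier integral is truncated to the lattice dual to `π ^ (ℓ - e) V_n(O)`.
Fubini and orthogonality of characters turn the truncated integral into the volume of that lattice
times the measure of the integral `v` with `π ^ e (A[v] - B) ≡ 0` modulo `π ^ ℓ`, hence into a
multiple of `repRatio` (`setIntegral_fourierIntegrand_gaussSum`). The factor `q ^ (n (n - 1))` is
the index of `V_n(O)` in its dual. By integrability the truncations converge to the full integral.
So the limits defining the densities exist, and their normalized values do not depend on `e`,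
because each is determined by the same integral. -/

theorem prime_coe_ne_zero {π : 𝒪[k]} (hπ : Irreducible π) : (π : k) ≠ 0 := by
  simpa using hπ.ne_zero

theorem zpow_mul_mem {π : 𝒪[k]} {x : k} (hx : x ∈ 𝒪[k]) {a : ℤ} (ha : 0 ≤ a) :
    (π : k) ^ a * x ∈ 𝒪[k] := by
  lift a to ℕ using ha
  rw [zpow_natCast]
  exact mul_mem (pow_mem π.2 a) hx

/-- The elements of `W` whose `i`-th coordinate lies in `π ^ (a i) 𝒪`. -/
def box {ι W : Type*} [AddCommGroup W] (π : 𝒪[k]) (φ : W →+ (ι → k)) (a : ι → ℤ) :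
    AddSubgroup W where
  carrier := {w | ∀ i, (π : k) ^ (-a i) * φ w i ∈ 𝒪[k]}
  zero_mem' := fun i => by simp
  add_mem' := fun {v w} hv hw i => by
    rw [map_add, Pi.add_apply, mul_add]
    exact add_mem (hv i) (hw i)
  neg_mem' := fun {v} hv i => by
    rw [map_neg, Pi.neg_apply, mul_neg]
    exact neg_mem (hv i)

theorem mem_box {ι W : Type*} [AddCommGroup W] {π : 𝒪[k]} {φ : W →+ (ι → k)} {a : ι → ℤ} {w : W} :
    w ∈ box π φ a ↔ ∀ i, (π : k) ^ (-a i) * φ w i ∈ 𝒪[k] := Iff.rfl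

theorem box_mono {ι W : Type*} [AddCommGroup W] {π : 𝒪[k]} (hπ : Irreducible π)
    (φ : W →+ (ι → k)) {a b : ι → ℤ} (hab : a ≤ b) : box π φ b ≤ box π φ a := by
  intro w hw i
  have := zpow_mul_mem (π := π) (hw i) (sub_nonneg.2 (hab i))
  rwa [← mul_assoc, ← zpow_add₀ (prime_coe_ne_zero hπ),
    show b i - a i + -b i = -a i by ring] at this

theorem card_quotient_span_pow [IsDiscreteValuationRing 𝒪[k]] {π : 𝒪[k]} (hπ : Irreducible π)
    (d : ℕ) : Nat.card (𝒪[k] ⧸ Ideal.span {π ^ d}) = residueCard k ^ d := by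
  rw [← Ideal.span_singleton_pow, ← hπ.maximalIdeal_eq]
  exact cardQuot_pow_of_prime (IsDiscreteValuationRing.not_a_field _)

/-- Reducing the rescaled coordinates modulo `π ^ (d i)` is a surjection onto a product of finite
rings whose kernel is the smaller box. -/
theorem box_relIndex [IsDiscreteValuationRing 𝒪[k]] {ι W : Type*} [Fintype ι] [AddCommGroup W]
    {π : 𝒪[k]} (hπ : Irreducible π) (φ : W →+ (ι → k)) (hφ : Function.Surjective φ) (a : ι → ℤ)
    (d : ι → ℕ) :
    (box π φ (fun i => a i + d i)).relIndex (box π φ a) = residueCard k ^ (∑ i, d i) := by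
  have h0 := prime_coe_ne_zero hπ
  let f : box π φ a →+ (∀ i, 𝒪[k] ⧸ Ideal.span {π ^ d i}) :=
    { toFun := fun w i => Ideal.Quotient.mk _ ⟨(π : k) ^ (-a i) * φ w i, w.2 i⟩
      map_zero' := by
        ext i
        rw [Pi.zero_apply, ← map_zero (Ideal.Quotient.mk _)]
        congr 1
        ext
        simp
      map_add' := fun v w => by
        ext i
        rw [Pi.add_apply, ← map_add]
        congr 1
        ext
        simp [mul_add] }
  have hker : f.ker = (box π φ (fun i => a i + d i)).addSubgroupOf (box π φ a) := by
    ext w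
    rw [AddMonoidHom.mem_ker, AddSubgroup.mem_addSubgroupOf, funext_iff]
    refine forall_congr' fun i => ?_
    change Ideal.Quotient.mk _ _ = 0 ↔ _
    rw [Ideal.Quotient.eq_zero_iff_mem, Ideal.mem_span_singleton]
    have key : (π : k) ^ (-a i) * φ w i = (π : k) ^ d i * ((π : k) ^ (-(a i + d i)) * φ w i) := by
      rw [neg_add, zpow_add₀ h0, zpow_neg _ (d i : ℤ), zpow_natCast]
      field_simp
    constructor
    · rintro ⟨z, hz⟩
      have hz' := congrArg Subtype.val hz
      simp only [Subring.coe_mul, SubmonoidClass.coe_pow] at hz'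
      rw [key] at hz'
      rw [mul_left_cancel₀ (pow_ne_zero _ h0) hz']
      exact z.2
    · intro h
      exact ⟨⟨_, h⟩, Subtype.ext (by simpa using key)⟩
  have hsurj : Function.Surjective f := by
    intro y
    choose z hz using fun i => Ideal.Quotient.mk_surjective (y i)
    obtain ⟨w, hw⟩ := hφ (fun i => (π : k) ^ a i * z i)
    have hw' : ∀ i, (π : k) ^ (-a i) * φ w i = z i := fun i => by
      rw [hw, ← mul_assoc, ← zpow_add₀ h0]; simp
    refine ⟨⟨w, fun i => ?_⟩, ?_⟩
    · rw [hw']; exact (z i).2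
    · ext i
      rw [← hz]
      exact congrArg _ (Subtype.ext (hw' i))
  rw [AddSubgroup.relIndex, ← hker, AddSubgroup.index_ker, AddMonoidHom.range_eq_top.2 hsurj,
    Nat.card_congr AddSubgroup.topEquiv.toEquiv, Nat.card_pi, ← Finset.prod_pow_eq_pow_sum]
  exact Finset.prod_congr rfl fun i _ => card_quotient_span_pow hπ (d i)

theorem exists_zpow_mul_mem [IsDiscreteValuationRing 𝒪[k]]
    {π : 𝒪[k]} (hπ : Irreducible π) (x : k) : ∃ t : ℕ, (π : k) ^ t * x ∈ 𝒪[k] := by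
  obtain ⟨y, z, hz, rfl⟩ := IsFractionRing.div_surjective (A := 𝒪[k]) x
  obtain ⟨t, w, hw⟩ := IsDiscreteValuationRing.eq_unit_mul_pow_irreducible
    (nonZeroDivisors.ne_zero hz) hπ
  refine ⟨t, ?_⟩
  have : (π : k) ^ t * (algebraMap 𝒪[k] k y / algebraMap 𝒪[k] k z)
      = ((w⁻¹ : 𝒪[k]ˣ) * y : 𝒪[k]) := by
    have h1 : ((w : 𝒪[k]) : k) * ((w⁻¹ : 𝒪[k]ˣ) : 𝒪[k]) = 1 := by
      rw [← Subring.coe_mul]; simp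
    have h0 := prime_coe_ne_zero hπ
    have h2 : ((w : 𝒪[k]) : k) ≠ 0 := left_ne_zero_of_mul_eq_one h1
    change (π : k) ^ t * ((y : k) / (z : k)) = _
    rw [hw]
    simp only [Subring.coe_mul, SubmonoidClass.coe_pow]
    field_simp
    linear_combination (-(y : k)) * h1
  rw [this]
  exact Subtype.prop _

theorem exists_mem_box [IsDiscreteValuationRing 𝒪[k]] {ι W : Type*} [Finite ι] [AddCommGroup W]
    {π : 𝒪[k]} (hπ : Irreducible π) (φ : W →+ (ι → k)) (a : ι → ℤ) (w : W) :
    ∃ t : ℕ, w ∈ box π φ (fun i => a i - t) := by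
  have := Fintype.ofFinite ι
  choose t ht using fun i => exists_zpow_mul_mem hπ ((π : k) ^ (-a i) * φ w i)
  refine ⟨∑ i, t i, fun i => ?_⟩
  have h1 : t i ≤ ∑ i, t i := Finset.single_le_sum (fun _ _ => Nat.zero_le _) (Finset.mem_univ i)
  have := zpow_mul_mem (π := π) (ht i) (a := (∑ i, t i : ℕ) - t i) (by omega)
  rwa [← zpow_natCast, ← mul_assoc, ← mul_assoc, ← zpow_add₀ (prime_coe_ne_zero hπ),
    ← zpow_add₀ (prime_coe_ne_zero hπ),
    show (∑ i, t i : ℕ) - (t i : ℤ) + t i + -a i = -(a i - (∑ i, t i : ℕ)) by ring] at this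

/-- The map factors through the quotient of two boxes, which has finite index. -/
theorem finite_map_box [IsDiscreteValuationRing 𝒪[k]] [Finite 𝓀[k]]
    {ι W Y : Type*} [Finite ι] [AddCommGroup W] [AddCommGroup Y]
    {π : 𝒪[k]} (hπ : Irreducible π) {φ : W →+ (ι → k)} (hφ : Function.Surjective φ) {a : ι → ℤ}
    {g : W →+ Y} (hg : box π φ a ≤ g.ker) (t : ℕ) :
    Finite ((box π φ (fun i => a i - t)).map g) := by
  have := Fintype.ofFinite ι
  refine Nat.finite_of_card_ne_zero ?_
  rw [← AddSubgroup.relIndex_ker]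
  refine fun h => ?_
  have h1 := box_relIndex hπ φ hφ (fun i => a i - t) (fun _ => t)
  simp only [sub_add_cancel] at h1
  have h2 := AddSubgroup.relIndex_eq_zero_of_le_left hg h
  rw [h2] at h1
  exact pow_ne_zero _ Nat.card_pos.ne' h1.symm

/-- The quotient is the union of the finite images of the boxes that exhaust `W`. Countability is
what turns integrals of functions on the quotient into sums. -/
theorem countable_of_box_le_ker [IsDiscreteValuationRing 𝒪[k]] [Finite 𝓀[k]]
    {ι W Y : Type*} [Finite ι] [AddCommGroup W] [AddCommGroup Y]
    {π : 𝒪[k]} (hπ : Irreducible π) {φ : W →+ (ι → k)} (hφ : Function.Surjective φ) {a : ι → ℤ}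
    {g : W →+ Y} (hg : box π φ a ≤ g.ker) (hs : Function.Surjective g) : Countable Y := by
  rw [← Set.countable_univ_iff]
  have : (Set.univ : Set Y) = ⋃ t : ℕ, ((box π φ (fun i => a i - t)).map g : Set Y) := by
    refine (Set.eq_univ_of_forall fun y => ?_).symm
    obtain ⟨w, rfl⟩ := hs y
    obtain ⟨t, ht⟩ := exists_mem_box hπ φ a w
    exact Set.mem_iUnion.2 ⟨t, w, ht, rfl⟩
  rw [this]
  refine Set.countable_iUnion fun t => ?_
  have := finite_map_box hπ hφ hg t
  exact (Set.toFinite (((box π φ (fun i => a i - t)).map g : AddSubgroup Y) : Set Y)).countable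

end Box

/-! ### Consequences of the residue of `u` being a nonsquare. -/

section Residue

variable {k : Type*} [Field k] [ValuativeRel k] {u : 𝒪[k]}

theorem isUnit_of_residue_not_isSquare (hu : ¬ IsSquare (IsLocalRing.residue 𝒪[k] u)) :
    IsUnit u := by
  rw [← IsLocalRing.residue_ne_zero_iff_isUnit]
  rintro h
  exact hu (h ▸ IsSquare.zero)

/-- In a finite field of characteristic `2` every element is a square. -/
theorem isUnit_two_of_residue_not_isSquare [Finite 𝓀[k]]
    (hu : ¬ IsSquare (IsLocalRing.residue 𝒪[k] u)) :
    IsUnit (2 : 𝒪[k]) := by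
  rw [← IsLocalRing.residue_ne_zero_iff_isUnit]
  intro h
  refine hu (FiniteField.isSquare_of_char_two ?_ _)
  rw [map_ofNat] at h
  exact CharP.ringChar_of_prime_eq_zero Nat.prime_two (by exact_mod_cast h)

/-- The norm form of `k(ε)` is anisotropic over the residue field. -/
theorem isUnit_sq_sub_mul_sq (hu : ¬ IsSquare (IsLocalRing.residue 𝒪[k] u)) {a b : 𝒪[k]}
    (hab : IsUnit a ∨ IsUnit b) : IsUnit (a ^ 2 - u * b ^ 2) := by
  rw [← IsLocalRing.residue_ne_zero_iff_isUnit, ← IsLocalRing.residue_ne_zero_iff_isUnit] at hab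
  rw [← IsLocalRing.residue_ne_zero_iff_isUnit]
  intro h
  simp only [map_sub, map_mul, map_pow] at h
  by_cases hb : IsLocalRing.residue 𝒪[k] b = 0
  · simp_all
  · refine hu ⟨IsLocalRing.residue 𝒪[k] a / IsLocalRing.residue 𝒪[k] b, ?_⟩
    field_simp
    linear_combination -h

end Residue

/-! ### Invariant measures, characters and quadratic phases on groups with compact open subgroups.
-/

section HaarLattice

variable {W : Type*} [AddCommGroup W] [TopologicalSpace W] [IsTopologicalAddGroup W]
  [MeasurableSpace W] [BorelSpace W] (μ : Measure W)

omit [TopologicalSpace W] [IsTopologicalAddGroup W] [BorelSpace W] in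
theorem measure_fiber_eq [MeasurableAdd W] [μ.IsAddLeftInvariant] {Y : Type*} [AddCommGroup Y] (g : W →+ Y)
    (w : W) : μ (g ⁻¹' {g w}) = μ (g.ker : Set W) := by
  rw [← measure_vadd μ w (g.ker : Set W)]
  congr 1
  ext x
  rw [Set.mem_vadd_set_iff_neg_vadd_mem]
  simp only [Set.mem_preimage, Set.mem_singleton_iff, vadd_eq_add, SetLike.mem_coe,
    AddMonoidHom.mem_ker, map_add, map_neg, neg_add_eq_zero]
  exact eq_comm

theorem measurableSet_fiber {Y : Type*} [AddCommGroup Y] {g : W →+ Y}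
    (hg : MeasurableSet (g.ker : Set W)) (w : W) : MeasurableSet (g ⁻¹' {g w}) := by
  have : g ⁻¹' {g w} = w +ᵥ (g.ker : Set W) := by
    ext x
    rw [Set.mem_vadd_set_iff_neg_vadd_mem]
    simp only [Set.mem_preimage, Set.mem_singleton_iff, vadd_eq_add, SetLike.mem_coe,
      AddMonoidHom.mem_ker, map_add, map_neg, neg_add_eq_zero]
    exact eq_comm
  rw [this]
  exact hg.const_vadd w

theorem lintegral_comp_addMonoidHom [μ.IsAddLeftInvariant] {Y : Type*} [AddCommGroup Y]
    [Countable Y] {g : W →+ Y} (hg : MeasurableSet (g.ker : Set W)) (F : Y → ENNReal) :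
    ∫⁻ w, F (g w) ∂μ = μ (g.ker : Set W) * ∑' y : g.range, F y := by
  have huniv : (Set.univ : Set W) = ⋃ y : g.range, g ⁻¹' {(y : Y)} := by
    refine (Set.eq_univ_of_forall fun w => ?_).symm
    exact Set.mem_iUnion.2 ⟨⟨g w, w, rfl⟩, rfl⟩
  have hmeas : ∀ y : g.range, MeasurableSet (g ⁻¹' {(y : Y)}) := by
    rintro ⟨_, w, rfl⟩
    exact measurableSet_fiber hg w
  rw [← setLIntegral_univ, huniv, lintegral_iUnion hmeas, ← ENNReal.tsum_mul_left]
  · refine tsum_congr ?_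
    rintro ⟨_, w, rfl⟩
    rw [setLIntegral_congr_fun (g := fun _ => F (g w)) (measurableSet_fiber hg w)
      (fun x hx => congrArg F hx), setLIntegral_const, measure_fiber_eq, mul_comm]
  · intro y z hyz
    refine Set.disjoint_left.2 fun w hy hz => hyz (Subtype.ext ?_)
    exact (Set.mem_singleton_iff.1 hy).symm.trans hz

/-- Passing from the range to all of `Y` permits forgetting the hermitian condition on the tuple of
rows later. -/
theorem lintegral_comp_addMonoidHom_le [μ.IsAddLeftInvariant] {Y : Type*} [AddCommGroup Y]
    [Countable Y] {g : W →+ Y} (hg : MeasurableSet (g.ker : Set W)) (F : Y → ENNReal) :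
    ∫⁻ w, F (g w) ∂μ ≤ μ (g.ker : Set W) * ∑' y, F y := by
  rw [lintegral_comp_addMonoidHom μ hg]
  gcongr
  exact ENNReal.tsum_comp_le_tsum_of_injective Subtype.val_injective F

theorem measure_preimage_eq [μ.IsAddLeftInvariant] {Y : Type*} [AddCommGroup Y]
    [Countable Y] {g : W →+ Y} (hg : MeasurableSet (g.ker : Set W)) (hs : Function.Surjective g)
    (T : Set Y) : MeasurableSet (g ⁻¹' T) ∧ μ (g ⁻¹' T) = μ (g.ker : Set W) * T.encard := by
  have hT : g ⁻¹' T = ⋃ y : T, g ⁻¹' {(y : Y)} := by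
    ext w; simp
  have hmeas : ∀ y : T, MeasurableSet (g ⁻¹' {(y : Y)}) := by
    rintro ⟨y, hy⟩
    obtain ⟨w, rfl⟩ := hs y
    exact measurableSet_fiber hg w
  refine ⟨hT ▸ MeasurableSet.iUnion hmeas, ?_⟩
  rw [hT, measure_iUnion _ hmeas]
  · have : ∀ y : T, μ (g ⁻¹' {(y : Y)}) = μ (g.ker : Set W) := by
      rintro ⟨y, hy⟩
      obtain ⟨w, rfl⟩ := hs y
      exact measure_fiber_eq μ g w
    simp_rw [this]
    rw [ENNReal.tsum_const, mul_comm, ENat.card_coe_set_eq]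
  · intro y z hyz
    refine Set.disjoint_left.2 fun w hy hz => hyz (Subtype.ext ?_)
    exact (Set.mem_singleton_iff.1 hy).symm.trans hz

theorem measure_eq_relIndex_mul [μ.IsAddLeftInvariant] {H K : AddSubgroup W} (hHK : H ≤ K)
    (hH : MeasurableSet (H : Set W)) (hf : H.relIndex K ≠ 0) :
    μ (K : Set W) = H.relIndex K * μ (H : Set W) := by
  have : Finite (K ⧸ H.addSubgroupOf K) := Nat.finite_of_card_ne_zero hf
  have hK : (K : Set W) = ⋃ c : K ⧸ H.addSubgroupOf K, ((c.out : K) : W) +ᵥ (H : Set W) := by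
    ext w
    simp only [SetLike.mem_coe, Set.mem_iUnion, Set.mem_vadd_set_iff_neg_vadd_mem, vadd_eq_add]
    constructor
    · intro hw
      refine ⟨QuotientAddGroup.mk ⟨w, hw⟩, ?_⟩
      have := QuotientAddGroup.eq.1 (QuotientAddGroup.out_eq'
        (QuotientAddGroup.mk ⟨w, hw⟩ : K ⧸ H.addSubgroupOf K))
      exact this
    · rintro ⟨c, hc⟩
      have := add_mem c.out.2 (hHK hc)
      simpa using this
  rw [hK, measure_iUnion _ fun c => hH.const_vadd _]
  · simp only [measure_vadd]
    rw [ENNReal.tsum_const, AddSubgroup.relIndex, AddSubgroup.index, Nat.card, ENat.card]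
    congr 1
    have : Cardinal.mk (K ⧸ H.addSubgroupOf K) < Cardinal.aleph0 := Cardinal.lt_aleph0_of_finite _
    rw [← ENat.card, ENat.card_eq_coe_natCard]
    rfl
  · intro c d hcd
    refine Set.disjoint_left.2 fun w hc hd => hcd ?_
    rw [Set.mem_vadd_set_iff_neg_vadd_mem] at hc hd
    rw [← QuotientAddGroup.out_eq' c, ← QuotientAddGroup.out_eq' d, QuotientAddGroup.eq]
    have := sub_mem hc hd
    simp only [vadd_eq_add, add_sub_add_right_eq_sub] at this
    rw [AddSubgroup.mem_addSubgroupOf]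
    simpa [sub_eq_add_neg] using this

theorem setIntegral_add_right_eq [μ.IsAddRightInvariant] {K : AddSubgroup W}
    (hK : MeasurableSet (K : Set W)) (f : W → ℂ) {x : W} (hx : x ∈ K) :
    ∫ w in (K : Set W), f (w + x) ∂μ = ∫ w in (K : Set W), f w ∂μ := by
  rw [← integral_indicator hK, ← integral_indicator hK,
    ← integral_add_right_eq_self (fun w => (K : Set W).indicator f w) x]
  refine integral_congr_ae (Filter.Eventually.of_forall fun w => ?_)
  have : w + x ∈ (K : Set W) ↔ w ∈ (K : Set W) := K.add_mem_cancel_right hx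
  by_cases hw : w ∈ (K : Set W)
  · simp only [Set.indicator_of_mem hw, Set.indicator_of_mem (this.2 hw)]
  · simp only [Set.indicator_of_notMem hw, Set.indicator_of_notMem (mt this.1 hw)]

omit [TopologicalSpace W] [IsTopologicalAddGroup W] [BorelSpace W] in
theorem setIntegral_addChar_of_trivial {K : AddSubgroup W} (hK : MeasurableSet (K : Set W))
    (χ : AddChar W Circle) (hχ : ∀ x ∈ K, χ x = 1) :
    ∫ w in (K : Set W), (χ w : ℂ) ∂μ = (μ.real (K : Set W) : ℂ) := by
  rw [setIntegral_congr_fun (g := fun _ => (1 : ℂ)) hK (fun x hx => by simp [hχ x hx])]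
  simp

/-- Translation by `x` multiplies the integral by `χ x ≠ 1`. -/
theorem setIntegral_addChar_of_nontrivial [μ.IsAddRightInvariant] {K : AddSubgroup W}
    (hK : MeasurableSet (K : Set W)) (χ : AddChar W Circle) {x : W} (hx : x ∈ K) (hχ : χ x ≠ 1) :
    ∫ w in (K : Set W), (χ w : ℂ) ∂μ = 0 := by
  have h := setIntegral_add_right_eq μ hK (fun w => (χ w : ℂ)) hx
  simp only [AddChar.map_add_eq_mul, Circle.coe_mul] at h
  rw [integral_mul_const] at h
  have h1 : (χ x : ℂ) ≠ 1 := fun h => hχ (Circle.ext h)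
  by_contra h0
  exact h1 (mul_left_cancel₀ h0 (by rw [h, mul_one]))

/-- The integrand cut off to a compact clopen product is continuous with compact support, so Fubini
needs neither σ-finiteness nor second countability. -/
theorem setIntegral_swap_of_isCompact {W' : Type*} [TopologicalSpace W'] [MeasurableSpace W']
    [BorelSpace W'] [R1Space W'] {ν : Measure W'}
    [IsFiniteMeasureOnCompacts μ] [IsFiniteMeasureOnCompacts ν]
    {K : Set W} {L : Set W'} (hK : IsClopen K) (hL : IsClopen L)
    (hKc : IsCompact K) (hLc : IsCompact L) {f : W → W' → ℂ} (hf : Continuous f.uncurry) :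
    ∫ x in K, ∫ y in L, f x y ∂ν ∂μ = ∫ y in L, ∫ x in K, f x y ∂μ ∂ν := by
  have key := integral_integral_swap_of_hasCompactSupport (μ := μ) (ν := ν)
    (f := fun x y => (K ×ˢ L).indicator f.uncurry (x, y))
    ((hK.prod hL).continuous_indicator hf)
    (HasCompactSupport.intro (hKc.prod hLc) fun p hp => Set.indicator_of_notMem hp _)
  have h1 : ∀ x, ∫ y, (K ×ˢ L).indicator f.uncurry (x, y) ∂ν
      = K.indicator (fun x => ∫ y in L, f x y ∂ν) x := by
    intro x
    by_cases hx : x ∈ K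
    · rw [Set.indicator_of_mem hx, ← integral_indicator hL.isOpen.measurableSet]
      refine integral_congr_ae (Filter.Eventually.of_forall fun y => ?_)
      by_cases hy : y ∈ L <;> simp [hx, hy]
    · simp [hx]
  have h2 : ∀ y, ∫ x, (K ×ˢ L).indicator f.uncurry (x, y) ∂μ
      = L.indicator (fun y => ∫ x in K, f x y ∂μ) y := by
    intro y
    by_cases hy : y ∈ L
    · rw [Set.indicator_of_mem hy, ← integral_indicator hK.isOpen.measurableSet]
      refine integral_congr_ae (Filter.Eventually.of_forall fun x => ?_)
      by_cases hx : x ∈ K <;> simp [hx, hy]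
    · simp [hy]
  simp_rw [h1, h2] at key
  rwa [integral_indicator hK.isOpen.measurableSet,
    integral_indicator hL.isOpen.measurableSet] at key

/-- Weyl differencing: the substitution `v = w + h` gives `|I|² = ∫ f h (∫ β h w dw) dh`. The inner
integral vanishes unless `β h` is trivial on `K`, which requires `h ∈ R`, and is otherwise at most
the measure of `K`. -/
theorem norm_sq_setIntegral_quadratic_le [μ.IsAddHaarMeasure] {K : AddSubgroup W}
    (hKo : IsClopen (K : Set W)) (hKc : IsCompact (K : Set W)) {f : W → Circle}
    (hf : Continuous f) {β : W → AddChar W Circle}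
    (hβ : ∀ v h, f (v + h) = f v * f h * β h v) {R : Set W} (hR : MeasurableSet R)
    (hKR : ∀ h ∈ K, h ∉ R → ∃ v ∈ K, β h v ≠ 1) :
    ‖∫ v in (K : Set W), (f v : ℂ) ∂μ‖ ^ 2 ≤ μ.real (K : Set W) * μ.real ((K : Set W) ∩ R) := by
  have hKm := hKo.isOpen.measurableSet
  have hfin : μ (K : Set W) ≠ ⊤ := hKc.measure_lt_top.ne
  set I := ∫ v in (K : Set W), (f v : ℂ) ∂μ with hI
  have h1 : I * (starRingEnd ℂ) I
      = ∫ h in (K : Set W), ∫ w in (K : Set W), (f h : ℂ) * (β h w : ℂ) ∂μ ∂μ := by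
    rw [hI, ← integral_conj, ← integral_const_mul, ← hI]
    rw [setIntegral_swap_of_isCompact (f := fun h w => (f h : ℂ) * (β h w : ℂ)) μ hKo hKo hKc hKc]
    · refine setIntegral_congr_fun hKm fun w hw => ?_
      rw [hI, ← setIntegral_add_right_eq μ hKm (fun v => (f v : ℂ)) hw, ← integral_mul_const]
      refine setIntegral_congr_fun hKm fun h _ => ?_
      rw [add_comm, hβ, Circle.coe_mul, Circle.coe_mul, ← Circle.coe_inv_eq_conj, Circle.coe_inv]
      field_simp [Circle.coe_ne_zero]
    -- Nothing is assumed about joint continuity of `β`; it follows because `f h * β h w` is the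
    -- quotient `f (w + h) / f w`.
    · have : (fun p : W × W => ((f p.1 : ℂ) * (β p.1 p.2 : ℂ)))
          = fun p => ((f (p.2 + p.1) * (f p.2)⁻¹ : Circle) : ℂ) := by
        ext p
        have : f p.1 * β p.1 p.2 = f (p.2 + p.1) * (f p.2)⁻¹ :=
          eq_mul_inv_of_mul_eq (by rw [hβ]; ac_rfl)
        rw [← Circle.coe_mul, this]
      change Continuous fun p : W × W => ((f p.1 : ℂ) * (β p.1 p.2 : ℂ))
      rw [this]
      fun_prop
  have h2 : ‖I‖ ^ 2 = ‖I * (starRingEnd ℂ) I‖ := by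
    rw [norm_mul, RCLike.norm_conj, sq]
  rw [h2, h1]
  have hint : IntegrableOn (R.indicator fun _ => μ.real (K : Set W)) (K : Set W) μ :=
    (integrableOn_const (hs := hfin)).indicator hR
  refine (norm_integral_le_of_norm_le hint
    ((ae_restrict_iff' hKm).2 (Filter.Eventually.of_forall fun h hh => ?_))).trans ?_
  · rw [integral_const_mul, norm_mul, Circle.norm_coe, one_mul]
    by_cases hhR : h ∈ R
    · rw [Set.indicator_of_mem hhR]
      refine (norm_setIntegral_le_of_norm_le_const (C := 1) hfin.lt_top fun v _ => ?_).trans ?_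
      · exact (Circle.norm_coe _).le
      · rw [one_mul]
    · obtain ⟨v, hv, hne⟩ := hKR h hh hhR
      rw [setIntegral_addChar_of_nontrivial μ hKm (β h) hv hne]
      simp [Set.indicator_of_notMem hhR]
  · rw [setIntegral_indicator hR, setIntegral_const, smul_eq_mul, mul_comm]

end HaarLattice

/-! ### Summing inverse orders of generated submodules over tuples. -/

section TupleSum

variable {R M : Type*} [Ring R] [AddCommGroup M] [Module R M]

/-- The inverse of the number of elements of a submodule, which is `0` for infinite submodules. -/
noncomputable def invCard (H : Submodule R M) : ENNReal := ((ENat.card H : ℕ∞) : ENNReal)⁻¹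

/-- Two elements with the same multiple by `ϖ` differ by an element of the kernel, so each fibre
over `H` has at most `N` elements. -/
theorem encard_preimage_smul_le {ϖ : R} {N : ℕ∞} (hN : ENat.card {x : M // ϖ • x = 0} ≤ N)
    (H : Submodule R M) : ENat.card {x : M // ϖ • x ∈ H} ≤ ENat.card H * N := by
  classical
  refine le_trans ?_ (mul_le_mul_right hN _)
  rw [← ENat.card_prod]
  let s : H → M := fun h => if hx : ∃ x : M, ϖ • x = h then hx.choose else 0
  have hs : ∀ x : M, ∀ hx : ϖ • x ∈ H, ϖ • s ⟨ϖ • x, hx⟩ = ϖ • x := by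
    intro x hx
    have h : ∃ y : M, ϖ • y = ((⟨ϖ • x, hx⟩ : H) : M) := ⟨x, rfl⟩
    simp only [s, dif_pos h]
    exact h.choose_spec
  refine ENat.card_le_card_of_injective
    (f := fun x : {x : M // ϖ • x ∈ H} => ((⟨ϖ • x.1, x.2⟩ : H),
      (⟨x.1 - s ⟨ϖ • x.1, x.2⟩, by rw [smul_sub, hs, sub_self]⟩ : {x : M // ϖ • x = 0}))) ?_
  rintro ⟨x, hx⟩ ⟨y, hy⟩ h
  simp only [Prod.mk.injEq, Subtype.mk.injEq] at h
  have h2 := h.2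
  simp only [h.1] at h2
  exact Subtype.ext (sub_left_injective h2)

theorem inv_pow_mul_pow_le {P : ENNReal} {Q : ENNReal} (hPQ : Q ≤ P) (h1 : 1 ≤ P) (hP : P ≠ ⊤)
    {d s : ℕ} (hs : d + 1 ≤ s) : P⁻¹ ^ s * P ^ d ≤ Q⁻¹ := by
  obtain ⟨r, rfl⟩ := Nat.exists_eq_add_of_le hs
  have h0 : P ≠ 0 := (zero_lt_one.trans_le h1).ne'
  calc P⁻¹ ^ (d + 1 + r) * P ^ d = (P⁻¹ * P) ^ d * (P⁻¹ ^ r * P⁻¹) := by ring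
    _ = P⁻¹ ^ r * P⁻¹ := by rw [ENNReal.inv_mul_cancel h0 hP, one_pow, one_mul]
    _ ≤ 1 * P⁻¹ := by
      gcongr
      exact pow_le_one₀ (zero_le) (ENNReal.inv_le_one.2 h1)
    _ ≤ Q⁻¹ := by rw [one_mul]; exact ENNReal.inv_le_inv.2 hPQ

variable {ϖ : R} {p d : ℕ}

/-- Sort the `x` by the least `t` with `ϖ ^ t • x ∈ H`. There are at most `|H| p ^ (d t)` of them,
and each enlarges `H` by a factor of at least `p ^ t`. Hence the sum is at most `|H| ^ (1 - s) ∑ p ^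
(t (d - s))`, and `s ≥ d + 1` makes this dominated by a geometric series of ratio `1 / 2`. -/
theorem tsum_invCard_sup_span_le (hp : 2 ≤ p)
    (htors : ∀ x : M, ∃ t : ℕ, ϖ ^ t • x = 0)
    (hker : ∀ t : ℕ, ENat.card {x : M // ϖ ^ t • x = 0} ≤ (p : ℕ∞) ^ (d * t))
    (hgrow : ∀ (H : Submodule R M) (x : M) (t : ℕ), (∀ j < t, ϖ ^ j • x ∉ H) →
      (p : ℕ∞) ^ t * ENat.card H ≤ ENat.card (H ⊔ Submodule.span R {x} : Submodule R M))
    (H : Submodule R M) {s : ℕ} (hs : d + 1 ≤ s) :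
    ∑' x : M, invCard (H ⊔ Submodule.span R {x}) ^ s ≤ 2 * invCard H ^ (s - 1) := by
  classical
  obtain ⟨s, rfl⟩ : ∃ r, s = r + 1 := ⟨s - 1, by omega⟩
  have hp0 : (p : ENNReal) ≠ 0 := by simp; omega
  have hle : ∀ (x : M) (t : ℕ), (∀ j < t, ϖ ^ j • x ∉ H) →
      invCard (H ⊔ Submodule.span R {x}) ≤ invCard H * ((p : ENNReal) ^ t)⁻¹ := by
    intro x t ht
    have h := hgrow H x t ht
    have h' : (p : ENNReal) ^ t * ((ENat.card H : ℕ∞) : ENNReal)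
        ≤ ((ENat.card (H ⊔ Submodule.span R {x} : Submodule R M) : ℕ∞) : ENNReal) := by
      have := ENat.toENNReal_le.2 h
      simpa using this
    rw [invCard, invCard, ← ENNReal.mul_inv]
    · rw [ENNReal.inv_le_inv, mul_comm]
      exact h'
    · right; exact ENNReal.pow_ne_top (ENNReal.natCast_ne_top p)
    · right; exact pow_ne_zero _ hp0
  -- For infinite `H` every term on the left is `0`; from here on `|H|` can be cancelled.
  by_cases hH : ENat.card H = ⊤
  · have h0 : ∀ x : M, invCard (H ⊔ Submodule.span R {x}) ^ (s + 1) = 0 := by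
      intro x
      have := hle x 0 (by simp)
      simp only [invCard, hH, ENat.toENNReal_top, ENNReal.inv_top, zero_mul, nonpos_iff_eq_zero]
        at this
      rw [invCard, this, zero_pow (by omega)]
    simp [h0]
  set c : ENNReal := ((ENat.card H : ℕ∞) : ENNReal) with hc
  have hc0 : c ≠ 0 := by
    rw [hc, Ne, ENat.toENNReal_eq_zero, ENat.card_eq_zero_iff_empty]
    simp
  have hct : c ≠ ⊤ := by rwa [hc, Ne, ENat.toENNReal_eq_top]
  have hcard : ∀ t, ((ENat.card {x : M // ϖ ^ t • x ∈ H} : ℕ∞) : ENNReal)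
      ≤ c * (p : ENNReal) ^ (d * t) := by
    intro t
    have := ENat.toENNReal_le.2 (encard_preimage_smul_le (hker t) H)
    simpa using this
  calc ∑' x : M, invCard (H ⊔ Submodule.span R {x}) ^ (s + 1)
      ≤ ∑' x : M, ∑' t : ℕ, {x : M | ϖ ^ t • x ∈ H}.indicator
          (fun _ => (c⁻¹ * ((p : ENNReal) ^ t)⁻¹) ^ (s + 1)) x := by
        refine ENNReal.tsum_le_tsum fun x => ?_
        have hex : ∃ t, ϖ ^ t • x ∈ H := by
          obtain ⟨t, ht⟩ := htors x
          exact ⟨t, by rw [ht]; exact H.zero_mem⟩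
        -- Overcounting is harmless: among all `t` with `ϖ ^ t • x ∈ H` the least one already gives
        -- the bound.
        refine le_trans ?_ (ENNReal.le_tsum (Nat.find hex))
        rw [Set.indicator_of_mem (s := {x : M | ϖ ^ Nat.find hex • x ∈ H}) (Nat.find_spec hex)]
        gcongr
        exact hle x _ fun j hj => Nat.find_min hex hj
    _ = ∑' t : ℕ, ((ENat.card {x : M // ϖ ^ t • x ∈ H} : ℕ∞) : ENNReal) *
          (c⁻¹ * ((p : ENNReal) ^ t)⁻¹) ^ (s + 1) := by
        rw [ENNReal.tsum_comm]
        refine tsum_congr fun t => ?_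
        rw [← tsum_subtype, ENNReal.tsum_const]
        rfl
    _ ≤ ∑' t : ℕ, c⁻¹ ^ s * (2⁻¹ : ENNReal) ^ t := by
        refine ENNReal.tsum_le_tsum fun t => ?_
        have h2 : (2 : ENNReal) ^ t ≤ (p : ENNReal) ^ t := by
          gcongr
          exact_mod_cast hp
        have h1 : (1 : ENNReal) ≤ (p : ENNReal) ^ t :=
          (one_le_pow₀ (by norm_num)).trans h2
        calc _ ≤ c * (p : ENNReal) ^ (d * t) * (c⁻¹ * ((p : ENNReal) ^ t)⁻¹) ^ (s + 1) := by
              gcongr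
              exact hcard t
          _ = (c * c⁻¹) * c⁻¹ ^ s *
                (((p : ENNReal) ^ t)⁻¹ ^ (s + 1) * ((p : ENNReal) ^ t) ^ d) := by
              rw [← pow_mul, mul_comm t d]; ring
          _ ≤ c⁻¹ ^ s * ((2 : ENNReal) ^ t)⁻¹ := by
              rw [ENNReal.mul_inv_cancel hc0 hct, one_mul]
              gcongr
              exact inv_pow_mul_pow_le h2 h1 (ENNReal.pow_ne_top (ENNReal.natCast_ne_top p)) hs
          _ = _ := by rw [ENNReal.inv_pow]
    _ = 2 * invCard H ^ (s + 1 - 1) := by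
        rw [ENNReal.tsum_mul_left, ENNReal.tsum_geometric, ENNReal.one_sub_inv_two, inv_inv,
          mul_comm]
        rfl

/-- Each generator removed from the tuple costs a factor `2` and one unit of the exponent, which
must stay at least `d + 1` until the last one; hence `d + i`. -/
theorem tsum_invCard_span_range_le (hp : 2 ≤ p)
    (htors : ∀ x : M, ∃ t : ℕ, ϖ ^ t • x = 0)
    (hker : ∀ t : ℕ, ENat.card {x : M // ϖ ^ t • x = 0} ≤ (p : ℕ∞) ^ (d * t))
    (hgrow : ∀ (H : Submodule R M) (x : M) (t : ℕ), (∀ j < t, ϖ ^ j • x ∉ H) →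
      (p : ℕ∞) ^ t * ENat.card H ≤ ENat.card (H ⊔ Submodule.span R {x} : Submodule R M))
    (i : ℕ) : ∀ s : ℕ, d + i ≤ s →
      ∑' c : Fin i → M, invCard (Submodule.span R (Set.range c)) ^ s ≤ 2 ^ i := by
  induction i with
  | zero =>
    intro s _
    rw [tsum_fintype]
    simp [invCard]
  | succ i ih =>
    intro s hs
    rw [← (Fin.consEquiv fun _ => M).tsum_eq]
    refine (ENNReal.tsum_prod (f := fun x c =>
      invCard (Submodule.span R (Set.range (Fin.cons x c : Fin (i + 1) → M))) ^ s)).trans_le ?_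
    rw [ENNReal.tsum_comm]
    calc _ ≤ ∑' c : Fin i → M, 2 * invCard (Submodule.span R (Set.range c)) ^ (s - 1) := by
          refine ENNReal.tsum_le_tsum fun c => ?_
          refine le_trans (le_of_eq (tsum_congr fun x => ?_)) (tsum_invCard_sup_span_le hp htors
            hker hgrow (Submodule.span R (Set.range c)) (s := s) (by omega))
          rw [Fin.range_cons, Submodule.span_insert, sup_comm]
      _ ≤ 2 ^ (i + 1) := by
          rw [ENNReal.tsum_mul_left, pow_succ']
          gcongr
          exact ih _ (by omega)

end TupleSum

/-! ### The torsion module `D ^ n / O ^ n`. -/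

section IntegerVectors

variable {k : Type*} [Field k] [ValuativeRel k] {u π : 𝒪[k]} {m n : ℕ}

/-- The coordinates of a quaternion with respect to `1, ε, Π, εΠ`. -/
def quatCoord (u π : 𝒪[k]) : Quat u π →+ (Fin 4 → k) where
  toFun := QuaternionAlgebra.equivTuple (u : k) 0 (π : k)
  map_zero' := by ext i; fin_cases i <;> rfl
  map_add' x y := by ext i; fin_cases i <;> rfl

theorem quatCoord_surjective : Function.Surjective (quatCoord u π) :=
  (QuaternionAlgebra.equivTuple (u : k) 0 (π : k)).surjective

theorem quatCoord_smul (r : k) (x : Quat u π) : quatCoord u π (r • x) = r • quatCoord u π x := by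
  ext i; fin_cases i <;> rfl

theorem mem_integers_iff {x : Quat u π} :
    x ∈ integers u π ↔ ∀ c, quatCoord u π x c ∈ 𝒪[k] := by
  rw [Fin.forall_fin_succ, Fin.forall_fin_succ, Fin.forall_fin_two]
  rfl

theorem smul_mem_integers {r : k} (hr : r ∈ 𝒪[k]) {x : Quat u π} (hx : x ∈ integers u π) :
    r • x ∈ integers u π := by
  rw [mem_integers_iff] at hx ⊢
  intro c
  rw [quatCoord_smul]
  exact mul_mem hr (hx c)

theorem star_mem_integers {x : Quat u π} (hx : x ∈ integers u π) : star x ∈ integers u π := by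
  obtain ⟨h1, h2, h3, h4⟩ := hx
  refine ⟨?_, ?_, ?_, ?_⟩ <;> simpa

/-- The element `a + bε` of the ring of integers of `D`. -/
def unramifiedElement (u π a b : 𝒪[k]) : integers u π :=
  ⟨⟨a, b, 0, 0⟩, a.2, b.2, zero_mem _, zero_mem _⟩

theorem unramifiedElement_mul (a b c d : 𝒪[k]) :
    unramifiedElement u π a b * unramifiedElement u π c d
      = unramifiedElement u π (a * c + u * b * d) (a * d + b * c) := by
  apply Subtype.ext
  ext <;> simp [unramifiedElement]

theorem unramifiedElement_sub (a b c d : 𝒪[k]) :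
    unramifiedElement u π a b - unramifiedElement u π c d
      = unramifiedElement u π (a - c) (b - d) := by
  apply Subtype.ext
  ext <;> simp [unramifiedElement]

theorem unramifiedElement_pow (a : 𝒪[k]) (t : ℕ) :
    unramifiedElement u π a 0 ^ t = unramifiedElement u π (a ^ t) 0 := by
  induction t with
  | zero => rw [pow_zero, pow_zero]; rfl
  | succ t ih => rw [pow_succ, ih, unramifiedElement_mul]; simp [pow_succ]

theorem coe_unramifiedElement_mul (a : 𝒪[k]) (x : Quat u π) :
    (unramifiedElement u π a 0 : Quat u π) * x = (a : k) • x := by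
  ext <;> simp [unramifiedElement]

/-- The vectors with entries in the ring of integers of `D`. -/
def integralVectors (u π : 𝒪[k]) (n : ℕ) : Submodule (integers u π) (Fin n → Quat u π) where
  carrier := {v | ∀ i, v i ∈ integers u π}
  zero_mem' _ := zero_mem _
  add_mem' ha hb i := add_mem (ha i) (hb i)
  smul_mem' r _ ha i := mul_mem r.2 (ha i)

/-- The torsion module `D ^ n / O ^ n`. -/
abbrev TorsionVectors (u π : 𝒪[k]) (n : ℕ) : Type _ :=
  (Fin n → Quat u π) ⧸ integralVectors u π n

theorem unramifiedElement_pow_smul (t : ℕ) (v : Fin n → Quat u π) :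
    unramifiedElement u π π 0 ^ t • v = (π : k) ^ t • v := by
  ext1 i
  rw [unramifiedElement_pow]
  exact coe_unramifiedElement_mul _ _

/-- The coordinates of a vector over `D`. -/
def vecCoord (u π : 𝒪[k]) (ι : Type*) : (ι → Quat u π) →+ (ι × Fin 4 → k) where
  toFun v p := quatCoord u π (v p.1) p.2
  map_zero' := by ext; simp
  map_add' v w := by ext; simp

theorem vecCoord_surjective {ι : Type*} : Function.Surjective (vecCoord u π ι) := by
  intro y
  choose v hv using fun i => quatCoord_surjective (u := u) (π := π) fun c => y (i, c)
  exact ⟨v, by ext p; exact congrFun (hv p.1) p.2⟩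

theorem mem_box_vecCoord {ι : Type*} {a : ℤ} {v : ι → Quat u π} :
    v ∈ box π (vecCoord u π ι) (fun _ => a) ↔ ∀ i, (π : k) ^ (-a) • v i ∈ integers u π := by
  simp only [mem_box, mem_integers_iff, quatCoord_smul, Prod.forall]
  rfl

theorem exists_pow_smul_mem_integers [IsDiscreteValuationRing 𝒪[k]] {ι : Type*} [Finite ι]
    (hπ : Irreducible π) (v : ι → Quat u π) :
    ∃ t : ℕ, ∀ i, (π : k) ^ t • v i ∈ integers u π := by
  obtain ⟨t, ht⟩ := exists_mem_box hπ (vecCoord u π ι) (fun _ => 0) v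
  refine ⟨t, fun i => ?_⟩
  simpa using mem_box_vecCoord.1 ht i

theorem integralVectors_eq_box (t : ℤ) {v : Fin n → Quat u π} :
    v ∈ box π (vecCoord u π (Fin n)) (fun _ => t) ↔ (π : k) ^ (-t) • v ∈ integralVectors u π n :=
  mem_box_vecCoord

theorem torsionVectors_mk_eq_zero {v : Fin n → Quat u π} :
    (integralVectors u π n).mkQ v = 0 ↔ v ∈ integralVectors u π n := by
  simp

theorem box_le_ker_mkQ : box π (vecCoord u π (Fin n)) (fun _ => 0) ≤
    (integralVectors u π n).mkQ.toAddMonoidHom.ker := by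
  intro v hv
  rw [integralVectors_eq_box] at hv
  rw [AddMonoidHom.mem_ker]
  exact torsionVectors_mk_eq_zero.2 (by simpa using hv)

theorem exists_eq_pow_mul_isUnit [IsDiscreteValuationRing 𝒪[k]] (hπ : Irreducible π) {a b : 𝒪[k]}
    (h : a ≠ 0 ∨ b ≠ 0) :
    ∃ (j : ℕ) (a₀ b₀ : 𝒪[k]), a = π ^ j * a₀ ∧ b = π ^ j * b₀ ∧ (IsUnit a₀ ∨ IsUnit b₀) := by
  rcases ValuationRing.dvd_total a b with ⟨c, rfl⟩ | ⟨c, rfl⟩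
  · have ha : a ≠ 0 := by rintro rfl; simp at h
    obtain ⟨j, w, rfl⟩ := IsDiscreteValuationRing.eq_unit_mul_pow_irreducible ha hπ
    exact ⟨j, w, w * c, mul_comm _ _, by ring, Or.inl w.isUnit⟩
  · have hb : b ≠ 0 := by rintro rfl; simp at h
    obtain ⟨j, w, rfl⟩ := IsDiscreteValuationRing.eq_unit_mul_pow_irreducible hb hπ
    exact ⟨j, w * c, w, by ring, mul_comm _ _, Or.inr w.isUnit⟩

/-- Write `a + bε = π ^ j (a₀ + b₀ε)` with `a₀` or `b₀` a unit. The norm of `a₀ + b₀ε` is then a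
unit, so multiplying by the conjugate over the norm gives `π ^ j x ∈ H`, whence `j ≥ t`. -/
theorem pow_dvd_of_unramifiedElement_smul_mem [IsDiscreteValuationRing 𝒪[k]]
    (hu : ¬ IsSquare (IsLocalRing.residue 𝒪[k] u)) (hπ : Irreducible π)
    {M : Type*} [AddCommGroup M] [Module (integers u π) M] {H : Submodule (integers u π) M} {x : M}
    {t : ℕ} (ht : ∀ j < t, unramifiedElement u π π 0 ^ j • x ∉ H) {a b : 𝒪[k]}
    (hab : unramifiedElement u π a b • x ∈ H) : π ^ t ∣ a ∧ π ^ t ∣ b := by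
  by_cases h : a ≠ 0 ∨ b ≠ 0
  · obtain ⟨j, a₀, b₀, rfl, rfl, h0⟩ := exists_eq_pow_mul_isUnit hπ h
    by_cases hj : t ≤ j
    · exact ⟨(pow_dvd_pow π hj).mul_right _, (pow_dvd_pow π hj).mul_right _⟩
    · obtain ⟨c, hc⟩ := (isUnit_sq_sub_mul_sq hu h0).exists_right_inv
      refine absurd ?_ (ht j (not_le.1 hj))
      have : unramifiedElement u π π 0 ^ j
          = unramifiedElement u π (c * a₀) (-(c * b₀)) *
            unramifiedElement u π (π ^ j * a₀) (π ^ j * b₀) := by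
        rw [unramifiedElement_pow, unramifiedElement_mul]
        congr 1
        · linear_combination (-(π ^ j)) * hc
        · ring
      rw [this, mul_smul]
      exact H.smul_mem _ hab
  · push Not at h
    simp [h.1, h.2]

/-- The multiples `(a + bε) x`, with `a` and `b` running through representatives modulo `π ^ t`, lie
in distinct cosets of `H`. This gives the growth factor `p ^ t` with `p = q ^ 2`. -/
theorem pow_mul_card_le_card_sup_span [IsDiscreteValuationRing 𝒪[k]] [Finite 𝓀[k]]
    (hu : ¬ IsSquare (IsLocalRing.residue 𝒪[k] u)) (hπ : Irreducible π)
    {M : Type*} [AddCommGroup M] [Module (integers u π) M] (H : Submodule (integers u π) M) (x : M)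
    (t : ℕ) (ht : ∀ j < t, unramifiedElement u π π 0 ^ j • x ∉ H) :
    ((residueCard k ^ 2 : ℕ) : ℕ∞) ^ t * ENat.card H
      ≤ ENat.card (H ⊔ Submodule.span (integers u π) {x} : Submodule (integers u π) M) := by
  have hcard := card_quotient_span_pow hπ t
  have hq : residueCard k ≠ 0 := Nat.card_pos.ne'
  have : Finite (𝒪[k] ⧸ Ideal.span {π ^ t}) :=
    Nat.finite_of_card_ne_zero (by rw [hcard]; exact pow_ne_zero _ hq)
  have h1 : ENat.card (𝒪[k] ⧸ Ideal.span {π ^ t}) = (residueCard k ^ t : ℕ) := by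
    rw [ENat.card_eq_coe_natCard, hcard]
  have h2 : ((residueCard k ^ 2 : ℕ) : ℕ∞) ^ t * ENat.card H
      = ENat.card (((𝒪[k] ⧸ Ideal.span {π ^ t}) × (𝒪[k] ⧸ Ideal.span {π ^ t})) × H) := by
    rw [ENat.card_prod, ENat.card_prod, h1]
    congr 1
    push_cast
    ring
  rw [h2]
  refine ENat.card_le_card_of_injective (f := fun p =>
    ⟨p.2 + unramifiedElement u π (Quotient.out p.1.1) (Quotient.out p.1.2) • x,
      Submodule.add_mem_sup p.2.2
        (Submodule.smul_mem _ _ (Submodule.mem_span_singleton_self x))⟩) ?_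
  rintro ⟨⟨a, b⟩, g⟩ ⟨⟨a', b'⟩, g'⟩ h
  simp only [Subtype.mk.injEq] at h
  have hmem : unramifiedElement u π (Quotient.out a - Quotient.out a')
      (Quotient.out b - Quotient.out b') • x ∈ H := by
    rw [← unramifiedElement_sub, sub_smul]
    have : unramifiedElement u π (Quotient.out a) (Quotient.out b) • x -
      unramifiedElement u π (Quotient.out a') (Quotient.out b') • x = (g' : M) - g := by
      rw [sub_eq_sub_iff_add_eq_add, add_comm, h, add_comm]
    rw [this]
    exact H.sub_mem g'.2 g.2
  obtain ⟨ha, hb⟩ := pow_dvd_of_unramifiedElement_smul_mem hu hπ ht hmem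
  have key : ∀ c d : 𝒪[k] ⧸ Ideal.span {π ^ t},
      π ^ t ∣ Quotient.out c - Quotient.out d → c = d := by
    intro c d hcd
    rw [← Ideal.mem_span_singleton, ← Ideal.Quotient.eq] at hcd
    rwa [Ideal.Quotient.mk_out, Ideal.Quotient.mk_out] at hcd
  obtain rfl := key _ _ ha
  obtain rfl := key _ _ hb
  simp only [add_left_inj, SetLike.coe_eq_coe] at h
  rw [h]

/-- The elements killed by `π ^ t` come from `π ^ (-t) O ^ n`, which contains `O ^ n` with index `q
^ (4nt)`; in terms of `p = q ^ 2` this means `d = 2n`. -/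
theorem card_torsion_le [IsDiscreteValuationRing 𝒪[k]] [Finite 𝓀[k]] (hπ : Irreducible π) (t : ℕ) :
    ENat.card {x : TorsionVectors u π n // unramifiedElement u π π 0 ^ t • x = 0}
      ≤ ((residueCard k ^ 2 : ℕ) : ℕ∞) ^ (2 * n * t) := by
  set g := (integralVectors u π n).mkQ.toAddMonoidHom with hg
  have hfin := finite_map_box hπ (vecCoord_surjective (u := u) (π := π)) box_le_ker_mkQ t (g := g)
  have hle : ENat.card {x : TorsionVectors u π n // unramifiedElement u π π 0 ^ t • x = 0}
      ≤ ENat.card ((box π (vecCoord u π (Fin n)) (fun _ => 0 - (t : ℤ))).map g) := by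
    refine ENat.card_le_card_of_injective (f := fun x => ⟨x.1, ?_⟩) ?_
    · obtain ⟨x, hx⟩ := x
      obtain ⟨v, rfl⟩ := (integralVectors u π n).mkQ_surjective x
      refine ⟨v, ?_, rfl⟩
      change v ∈ box _ _ _
      rw [integralVectors_eq_box]
      rw [← map_smul, torsionVectors_mk_eq_zero, unramifiedElement_pow_smul] at hx
      simpa using hx
    · intro x y h
      exact Subtype.ext (Subtype.mk.inj h)
  refine hle.trans ?_
  rw [ENat.card_eq_coe_natCard, ← AddSubgroup.relIndex_ker]
  have h1 := box_relIndex hπ (vecCoord u π (Fin n)) vecCoord_surjective (fun _ => 0 - (t : ℤ))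
    (fun _ => t)
  simp only [sub_add_cancel] at h1
  have h2 : g.ker = box π (vecCoord u π (Fin n)) (fun _ => 0) := by
    refine le_antisymm (fun v hv => ?_) box_le_ker_mkQ
    rw [integralVectors_eq_box]
    simpa using torsionVectors_mk_eq_zero.1 hv
  rw [h2, h1]
  simp only [Finset.sum_const, Finset.card_univ, Fintype.card_prod, Fintype.card_fin, smul_eq_mul]
  rw [← Nat.cast_pow, ← pow_mul]
  apply le_of_eq
  congr 2
  ring

theorem countable_torsionVectors [IsDiscreteValuationRing 𝒪[k]] [Finite 𝓀[k]]
    (hπ : Irreducible π) : Countable (TorsionVectors u π n) :=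
  countable_of_box_le_ker hπ (vecCoord_surjective (u := u) (π := π)) box_le_ker_mkQ
    (integralVectors u π n).mkQ_surjective

theorem tsum_invCard_torsionVectors_le [IsDiscreteValuationRing 𝒪[k]] [Finite 𝓀[k]]
    (hu : ¬ IsSquare (IsLocalRing.residue 𝒪[k] u)) (hπ : Irreducible π) (n : ℕ) :
    ∑' c : Fin n → TorsionVectors u π n,
      invCard (Submodule.span (integers u π) (Set.range c)) ^ (3 * n) ≤ 2 ^ n := by
  -- The exponent `3n` is exactly `d + n` with `d = 2n`.
  refine tsum_invCard_span_range_le (ϖ := unramifiedElement u π π 0) (p := residueCard k ^ 2)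
    (d := 2 * n) ?_ ?_ (card_torsion_le hπ) (fun H x t => pow_mul_card_le_card_sup_span hu hπ H x t)
    n (3 * n) (by omega)
  · have : 1 < residueCard k := Finite.one_lt_card
    nlinarith
  · intro x
    obtain ⟨v, rfl⟩ := (integralVectors u π n).mkQ_surjective x
    obtain ⟨t, ht⟩ := exists_pow_smul_mem_integers hπ v
    refine ⟨t, ?_⟩
    rw [← map_smul, torsionVectors_mk_eq_zero, unramifiedElement_pow_smul]
    exact ht

end IntegerVectors

/-! ### Topology of `D` and of matrices over `D`. -/

section LocalField

variable {k : Type*} [Field k] [ValuativeRel k] [TopologicalSpace k] [IsNonarchimedeanLocalField k]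

theorem isOpen_valuativeIntegers : IsOpen (𝒪[k] : Set k) := by
  refine AddSubgroup.isOpen_of_mem_nhds (𝒪[k]).toAddSubgroup (g := 0) ?_
  refine (IsValuativeTopology.hasBasis_nhds_zero' k).mem_iff.2 ⟨1, one_ne_zero, fun x hx => ?_⟩
  exact (Valuation.mem_integer_iff _ _).2 (le_of_lt hx)

theorem isCompact_valuativeIntegers : IsCompact (𝒪[k] : Set k) :=
  isCompact_iff_compactSpace.2 (inferInstanceAs (CompactSpace 𝒪[k]))

theorem continuous_of_eq_on_cosets {W Z : Type*} [AddGroup W] [TopologicalSpace W]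
    [IsTopologicalAddGroup W] [TopologicalSpace Z] {U : AddSubgroup W} (hU : IsOpen (U : Set W))
    {f : W → Z} (hf : ∀ x, ∀ h ∈ U, f (x + h) = f x) : Continuous f := by
  refine continuous_iff_continuousAt.2 fun x => ?_
  refine continuousAt_const.congr (f := fun _ => f x) ?_
  have : (fun y => -x + y) ⁻¹' (U : Set W) ∈ 𝓝 x :=
    (continuous_const.add continuous_id).continuousAt.preimage_mem_nhds
      (hU.mem_nhds (by simp))
  filter_upwards [this] with y hy
  rw [← hf x _ hy, add_neg_cancel_left]

omit [TopologicalSpace k] [IsNonarchimedeanLocalField k] in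
theorem HasConductorIntegers.apply_eq_one {ψ : AddChar k Circle} (hψ : HasConductorIntegers ψ)
    {x : k} (hx : x ∈ 𝒪[k]) : ψ x = 1 := by
  simpa using (hψ x).2 hx 1 (one_mem _)

/-- Continuity is automatic: `ψ` is constant on the cosets of the open subgroup `𝒪[k]`. -/
theorem HasConductorIntegers.continuous {ψ : AddChar k Circle} (hψ : HasConductorIntegers ψ) :
    Continuous ψ := by
  refine continuous_of_eq_on_cosets (U := (𝒪[k]).toAddSubgroup) isOpen_valuativeIntegers
    fun x h hh => ?_
  rw [AddChar.map_add_eq_mul, hψ.apply_eq_one hh, mul_one]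

variable {u π : 𝒪[k]}

omit [IsNonarchimedeanLocalField k] in
theorem continuous_quat_iff {X : Type*} [TopologicalSpace X] {f : X → Quat u π} :
    Continuous f ↔ Continuous (fun x => (f x).re) ∧ Continuous (fun x => (f x).imI) ∧
      Continuous (fun x => (f x).imJ) ∧ Continuous (fun x => (f x).imK) := by
  rw [continuous_induced_rng, ← continuous_prodMk, ← continuous_prodMk, ← continuous_prodMk]
  rfl

omit [IsNonarchimedeanLocalField k] in
@[fun_prop]
theorem continuous_re : Continuous (fun x : Quat u π => x.re) :=
  (continuous_quat_iff.1 continuous_id).1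

omit [IsNonarchimedeanLocalField k] in
@[fun_prop]
theorem continuous_imI : Continuous (fun x : Quat u π => x.imI) :=
  (continuous_quat_iff.1 continuous_id).2.1

omit [IsNonarchimedeanLocalField k] in
@[fun_prop]
theorem continuous_imJ : Continuous (fun x : Quat u π => x.imJ) :=
  (continuous_quat_iff.1 continuous_id).2.2.1

omit [IsNonarchimedeanLocalField k] in
@[fun_prop]
theorem continuous_imK : Continuous (fun x : Quat u π => x.imK) :=
  (continuous_quat_iff.1 continuous_id).2.2.2

instance : IsTopologicalRing (Quat u π) where
  continuous_add := by
    rw [continuous_quat_iff]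
    simp only [QuaternionAlgebra.re_add, QuaternionAlgebra.imI_add, QuaternionAlgebra.imJ_add,
      QuaternionAlgebra.imK_add]
    refine ⟨?_, ?_, ?_, ?_⟩ <;> fun_prop
  continuous_mul := by
    rw [continuous_quat_iff]
    simp only [QuaternionAlgebra.re_mul, QuaternionAlgebra.imI_mul, QuaternionAlgebra.imJ_mul,
      QuaternionAlgebra.imK_mul]
    refine ⟨?_, ?_, ?_, ?_⟩ <;> fun_prop
  continuous_neg := by
    rw [continuous_quat_iff]
    simp only [QuaternionAlgebra.re_neg, QuaternionAlgebra.imI_neg, QuaternionAlgebra.imJ_neg,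
      QuaternionAlgebra.imK_neg]
    refine ⟨?_, ?_, ?_, ?_⟩ <;> fun_prop

instance : ContinuousStar (Quat u π) where
  continuous_star := by
    rw [continuous_quat_iff]
    simp only [QuaternionAlgebra.re_star, QuaternionAlgebra.imI_star, QuaternionAlgebra.imJ_star,
      QuaternionAlgebra.imK_star]
    refine ⟨?_, ?_, ?_, ?_⟩ <;> fun_prop

instance : ContinuousConstSMul k (Quat u π) where
  continuous_const_smul r := by
    rw [continuous_quat_iff]
    simp only [QuaternionAlgebra.re_smul, QuaternionAlgebra.imI_smul, QuaternionAlgebra.imJ_smul,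
      QuaternionAlgebra.imK_smul, smul_eq_mul]
    refine ⟨?_, ?_, ?_, ?_⟩ <;> fun_prop

theorem isOpen_integers : IsOpen (integers u π : Set (Quat u π)) :=
  ((isOpen_valuativeIntegers.preimage continuous_re).inter
    ((isOpen_valuativeIntegers.preimage continuous_imI).inter
      ((isOpen_valuativeIntegers.preimage continuous_imJ).inter
        (isOpen_valuativeIntegers.preimage continuous_imK))))

theorem isCompact_integers : IsCompact (integers u π : Set (Quat u π)) := by
  let e := (QuaternionAlgebra.equivProd (u : k) 0 (π : k)).toHomeomorphOfIsInducing
    (Y := k × k × k × k) (X := Quat u π) ⟨rfl⟩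
  have := (isCompact_valuativeIntegers (k := k)).prod ((isCompact_valuativeIntegers (k := k)).prod
    ((isCompact_valuativeIntegers (k := k)).prod (isCompact_valuativeIntegers (k := k))))
  exact (e.isCompact_preimage).2 this

variable {m n : ℕ}

theorem isOpen_integralMatrices :
    IsOpen (integralMatrices u π m n : Set (Matrix (Fin m) (Fin n) (Quat u π))) := by
  have : (integralMatrices u π m n : Set (Matrix (Fin m) (Fin n) (Quat u π)))
      = ⋂ i, ⋂ j, (fun v => v i j) ⁻¹' (integers u π : Set (Quat u π)) := by
    ext v
    simp only [Set.mem_iInter]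
    rfl
  rw [this]
  exact isOpen_iInter_of_finite fun i => isOpen_iInter_of_finite fun j =>
    isOpen_integers.preimage (continuous_id.matrix_elem i j)

theorem isCompact_integralMatrices :
    IsCompact (integralMatrices u π m n : Set (Matrix (Fin m) (Fin n) (Quat u π))) := by
  have := isCompact_univ_pi (X := fun _ : Fin m => Fin n → Quat u π) fun _ =>
    isCompact_univ_pi fun _ : Fin n => isCompact_integers (u := u) (π := π)
  change IsCompact (X := Fin m → Fin n → Quat u π) {v | ∀ i j, v i j ∈ integers u π}
  convert this using 1
  ext v
  simp only [Set.mem_pi, Set.mem_univ, true_implies]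
  rfl

theorem isClopen_integralMatrices :
    IsClopen (integralMatrices u π m n : Set (Matrix (Fin m) (Fin n) (Quat u π))) :=
  ⟨AddSubgroup.isClosed_of_isOpen _ isOpen_integralMatrices, isOpen_integralMatrices⟩

theorem isCompact_smul_mem_integralMatrices {r : k} (hr : r ≠ 0) :
    IsCompact {v : Matrix (Fin m) (Fin n) (Quat u π) | r • v ∈ integralMatrices u π m n} := by
  have := (isCompact_integralMatrices (u := u) (π := π) (m := m) (n := n)).image
    (continuous_const_smul r⁻¹)
  convert this using 1
  ext v
  simp only [Set.mem_image, SetLike.mem_coe, Set.mem_ofPred_eq]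
  constructor
  · intro h
    exact ⟨_, h, inv_smul_smul₀ hr v⟩
  · rintro ⟨w, hw, rfl⟩
    rwa [smul_inv_smul₀ hr]

end LocalField

/-! ### The pairing as the real part of a trace. -/

section RealTrace

variable {k : Type*} [Field k] [ValuativeRel k] {u π : 𝒪[k]} {m n : ℕ}

/-- The real part of the trace of a matrix over `D`, that is half of its reduced trace. -/
def reTrace (n : ℕ) : Matrix (Fin n) (Fin n) (Quat u π) →+ k where
  toFun X := X.trace.re
  map_zero' := by simp
  map_add' X Y := by simp

theorem re_sum {ι : Type*} (s : Finset ι) (f : ι → Quat u π) :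
    (∑ i ∈ s, f i).re = ∑ i ∈ s, (f i).re :=
  map_sum (⟨⟨QuaternionAlgebra.re, rfl⟩, fun _ _ => rfl⟩ : Quat u π →+ k) f s

theorem re_mul_comm (x y : Quat u π) : (x * y).re = (y * x).re := by
  simp only [QuaternionAlgebra.re_mul]; ring

theorem re_star' (x : Quat u π) : (star x).re = x.re := by simp

theorem reTrace_mul_eq (X : Matrix (Fin m) (Fin n) (Quat u π))
    (Y : Matrix (Fin n) (Fin m) (Quat u π)) :
    reTrace m (X * Y) = ∑ i, ∑ j, (X i j * Y j i).re := by
  simp only [reTrace, AddMonoidHom.coe_mk, ZeroHom.coe_mk, Matrix.trace, Matrix.diag,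
    Matrix.mul_apply, re_sum]

theorem reTrace_mul_comm (X : Matrix (Fin m) (Fin n) (Quat u π))
    (Y : Matrix (Fin n) (Fin m) (Quat u π)) : reTrace m (X * Y) = reTrace n (Y * X) := by
  rw [reTrace_mul_eq, reTrace_mul_eq, Finset.sum_comm]
  simp only [re_mul_comm (X _ _)]

theorem reTrace_conjTranspose (X : Matrix (Fin n) (Fin n) (Quat u π)) :
    reTrace n Xᴴ = reTrace n X := by
  simp only [reTrace, AddMonoidHom.coe_mk, ZeroHom.coe_mk, Matrix.trace_conjTranspose, re_star']

theorem reTrace_mem {X : Matrix (Fin n) (Fin n) (Quat u π)} (hX : X ∈ integralMatrices u π n n) :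
    reTrace n X ∈ 𝒪[k] := by
  have : X.trace ∈ integers u π := sum_mem fun i _ => hX i i
  exact this.1

theorem diag_eq_re (h2 : (2 : k) ≠ 0) {X : Matrix (Fin n) (Fin n) (Quat u π)} (hX : Xᴴ = X)
    (i : Fin n) : X i i = ⟨(X i i).re, 0, 0, 0⟩ := by
  have h : star (X i i) = X i i := congrFun (congrFun hX i) i
  have aux : ∀ y : k, -y = y → y = 0 := fun y hy => by
    have : 2 * y = 0 := by linear_combination -hy
    simpa [h2] using this
  rw [QuaternionAlgebra.ext_iff] at h
  obtain ⟨-, h1, h2, h3⟩ := h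
  simp only [QuaternionAlgebra.imI_star, QuaternionAlgebra.imJ_star, QuaternionAlgebra.imK_star]
    at h1 h2 h3
  ext
  · rfl
  · exact aux _ h1
  · exact aux _ h2
  · exact aux _ h3

/-- For hermitian matrices the `(i, j)` and `(j, i)` terms have the same real part, and the reduced
trace of one of them is their sum. The trace form is invariant under cyclic permutation, which the
ordered sum hides. -/
theorem pairing_eq_reTrace (h2 : (2 : k) ≠ 0) {X Y : Matrix (Fin n) (Fin n) (Quat u π)}
    (hX : Xᴴ = X) (hY : Yᴴ = Y) : pairing X Y = reTrace n (X * Y) := by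
  have hswap : ∀ i j, (X i j * Y j i).re = (X j i * Y i j).re := by
    intro i j
    have h1 : X i j = star (X j i) := (congrFun (congrFun hX i) j).symm
    have h2 : Y j i = star (Y i j) := (congrFun (congrFun hY j) i).symm
    rw [h1, h2, ← star_mul, re_star', re_mul_comm]
  have hdiag : ∀ i, (X i i * Y i i).re = (X i i).re * (Y i i).re := by
    intro i
    rw [diag_eq_re h2 hX i, diag_eq_re h2 hY i]
    simp
  have htrd : ∀ i j, trd (X i j * Y j i) = (X i j * Y j i).re + (X j i * Y i j).re := by
    intro i j
    rw [trd, QuaternionAlgebra.re_add, re_star', hswap i j]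
  have hsplit : ∀ i, ∑ j, (X i j * Y j i).re = (X i i * Y i i).re +
      (∑ j ∈ Finset.univ.filter (fun j => i < j), (X i j * Y j i).re
        + ∑ j ∈ Finset.univ.filter (fun j => j < i), (X i j * Y j i).re) := by
    intro i
    rw [← Finset.sum_filter_add_sum_filter_not Finset.univ (fun j => j = i)]
    congr 1
    · rw [Finset.filter_eq']; simp
    · rw [← Finset.sum_filter_add_sum_filter_not _ (fun j => i < j), Finset.filter_filter,
        Finset.filter_filter]
      congr 1 <;> refine Finset.sum_congr (Finset.filter_congr fun j _ => ?_) fun _ _ => rfl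
      · constructor
        · exact fun h => h.2
        · exact fun h => ⟨h.ne', h⟩
      · rw [not_lt]
        exact ⟨fun h => lt_of_le_of_ne h.2 h.1, fun h => ⟨h.ne, h.le⟩⟩
  rw [reTrace_mul_eq, pairing]
  simp only [hsplit, htrd, Finset.sum_add_distrib, hdiag]
  congr 2
  simp only [Finset.sum_filter]
  rw [Finset.sum_comm]

end RealTrace

/-! ### Row modules and the polar character of the quadratic phase. -/

section GaussSum

variable {k : Type*} [Field k] [ValuativeRel k] {u π : 𝒪[k]} {l m n : ℕ}

theorem mul_mem_integralMatrices {X : Matrix (Fin l) (Fin m) (Quat u π)}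
    {Y : Matrix (Fin m) (Fin n) (Quat u π)} (hX : X ∈ integralMatrices u π l m)
    (hY : Y ∈ integralMatrices u π m n) : X * Y ∈ integralMatrices u π l n := by
  intro i j
  rw [Matrix.mul_apply]
  exact sum_mem fun c _ => mul_mem (hX i c) (hY c j)

theorem conjTranspose_mem_integralMatrices {X : Matrix (Fin m) (Fin n) (Quat u π)}
    (hX : X ∈ integralMatrices u π m n) : Xᴴ ∈ integralMatrices u π n m :=
  fun i j => star_mem_integers (hX j i)

theorem smul_mem_integralMatrices {r : k} (hr : r ∈ 𝒪[k]) {X : Matrix (Fin m) (Fin n) (Quat u π)}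
    (hX : X ∈ integralMatrices u π m n) : r • X ∈ integralMatrices u π m n :=
  fun i j => smul_mem_integers hr (hX i j)

theorem exists_pow_smul_mem_integralMatrices [IsDiscreteValuationRing 𝒪[k]] (hπ : Irreducible π)
    (X : Matrix (Fin m) (Fin n) (Quat u π)) :
    ∃ t : ℕ, (π : k) ^ t • X ∈ integralMatrices u π m n := by
  obtain ⟨t, ht⟩ := exists_pow_smul_mem_integers hπ fun p : Fin m × Fin n => X p.1 p.2
  exact ⟨t, fun i j => ht (i, j)⟩

/-- The basis `1, ε, Π, εΠ` detects integrality up to a factor `π` under the pairing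
`(x, y) ↦ Trd (x* y)`. -/
theorem smul_mem_integers_of_re_mul_mem (hu : IsUnit u) (h2 : IsUnit (2 : 𝒪[k])) {x : Quat u π}
    (hx : ∀ y ∈ integers u π, 2 * (star y * x).re ∈ 𝒪[k]) : (π : k) • x ∈ integers u π := by
  have hunit : ∀ {v : 𝒪[k]}, IsUnit v → ∀ {z : k}, (v : k) * z ∈ 𝒪[k] → z ∈ 𝒪[k] := by
    intro v hv z hz
    obtain ⟨w, hw⟩ := hv.exists_left_inv
    have := mul_mem w.2 hz
    rwa [← mul_assoc, ← Subring.coe_mul, hw, Subring.coe_one, one_mul] at this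
  have h2' : ∀ {z : k}, 2 * z ∈ 𝒪[k] → z ∈ 𝒪[k] := fun hz => hunit h2 (by exact_mod_cast hz)
  have hbasis : ∀ y ∈ integers u π, (star y * x).re ∈ 𝒪[k] := fun y hy => h2' (hx y hy)
  have e1 := hbasis ⟨1, 0, 0, 0⟩ ⟨one_mem _, zero_mem _, zero_mem _, zero_mem _⟩
  have e2 := hbasis ⟨0, 1, 0, 0⟩ ⟨zero_mem _, one_mem _, zero_mem _, zero_mem _⟩
  have e3 := hbasis ⟨0, 0, 1, 0⟩ ⟨zero_mem _, zero_mem _, one_mem _, zero_mem _⟩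
  have e4 := hbasis ⟨0, 0, 0, 1⟩ ⟨zero_mem _, zero_mem _, zero_mem _, one_mem _⟩
  simp only [QuaternionAlgebra.re_mul, QuaternionAlgebra.re_star, QuaternionAlgebra.imI_star,
    QuaternionAlgebra.imJ_star, QuaternionAlgebra.imK_star, neg_zero, zero_mul, mul_zero, mul_one,
    add_zero, zero_add, sub_zero, one_mul, neg_mul, mul_neg, neg_mem_iff, zero_sub, neg_neg]
    at e1 e2 e3 e4
  refine ⟨mul_mem π.2 e1, mul_mem π.2 (hunit hu e2), e3, hunit hu ?_⟩
  simpa [mul_assoc] using e4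

/-- The rows of `X` modulo the integral vectors. -/
def rowsMod (u π : 𝒪[k]) (m n : ℕ) :
    Matrix (Fin m) (Fin n) (Quat u π) →+ (Fin m → TorsionVectors u π n) where
  toFun X i := (integralVectors u π n).mkQ (X i)
  map_zero' := by ext1 i; exact map_zero _
  map_add' X Y := by ext1 i; exact map_add _ _ _

theorem rowsMod_eq_zero {X : Matrix (Fin m) (Fin n) (Quat u π)} :
    rowsMod u π m n X = 0 ↔ X ∈ integralMatrices u π m n := by
  rw [funext_iff]
  exact forall_congr' fun i => torsionVectors_mk_eq_zero

theorem mkQ_row_mul (h : Matrix (Fin l) (Fin m) (Quat u π)) (hh : h ∈ integralMatrices u π l m)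
    (C : Matrix (Fin m) (Fin n) (Quat u π)) (i : Fin l) :
    rowsMod u π l n (h * C) i = ∑ j, (⟨h i j, hh i j⟩ : integers u π) • rowsMod u π m n C j := by
  change (integralVectors u π n).mkQ _ = ∑ j, _ • (integralVectors u π n).mkQ _
  simp_rw [← map_smul]
  rw [← map_sum]
  congr 1
  ext1 c
  rw [Matrix.mul_apply, Finset.sum_apply]
  rfl

/-- The `O`-submodule of `D ^ n / O ^ n` generated by the rows of `C`. -/
def rowSpan (C : Matrix (Fin m) (Fin n) (Quat u π)) :
    Submodule (integers u π) (TorsionVectors u π n) :=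
  Submodule.span (integers u π) (Set.range (rowsMod u π m n C))

/-- The coordinates of a matrix over `D`. -/
def matCoord (u π : 𝒪[k]) (m n : ℕ) :
    Matrix (Fin m) (Fin n) (Quat u π) →+ ((Fin m × Fin n) × Fin 4 → k) where
  toFun X := vecCoord u π (Fin m × Fin n) fun p => X p.1 p.2
  map_zero' := map_zero _
  map_add' X Y := map_add (vecCoord u π (Fin m × Fin n)) (fun p : Fin m × Fin n => X p.1 p.2)
    (fun p : Fin m × Fin n => Y p.1 p.2)

theorem matCoord_surjective : Function.Surjective (matCoord u π m n) := by
  intro y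
  obtain ⟨v, hv⟩ := vecCoord_surjective (u := u) (π := π) y
  exact ⟨Matrix.of fun i j => v (i, j), hv⟩

theorem mem_box_matCoord {a : ℤ} {X : Matrix (Fin m) (Fin n) (Quat u π)} :
    X ∈ box π (matCoord u π m n) (fun _ => a) ↔ (π : k) ^ (-a) • X ∈ integralMatrices u π m n := by
  refine (mem_box_vecCoord (v := fun p : Fin m × Fin n => X p.1 p.2)).trans ?_
  exact Prod.forall

/-- The homomorphism `h ↦ hC` from matrices to their rows modulo integral vectors. -/
def mulRowsMod (l : ℕ) (C : Matrix (Fin m) (Fin n) (Quat u π)) :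
    Matrix (Fin l) (Fin m) (Quat u π) →+ (Fin l → TorsionVectors u π n) where
  toFun h := rowsMod u π l n (h * C)
  map_zero' := by rw [Matrix.zero_mul, map_zero]
  map_add' X Y := by rw [Matrix.add_mul, map_add]

/-- Each row of `h * C` is an arbitrary `O`-combination of the rows of `C`, chosen independently of
the other rows. -/
theorem mem_map_mulRowsMod (C : Matrix (Fin m) (Fin n) (Quat u π))
    (y : Fin l → TorsionVectors u π n) :
    y ∈ (integralMatrices u π l m).map (mulRowsMod l C) ↔ ∀ i, y i ∈ rowSpan C := by
  constructor
  · rintro ⟨h, hh, rfl⟩ i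
    change rowsMod u π l n (h * C) i ∈ _
    rw [mkQ_row_mul h hh]
    exact sum_mem fun j _ => Submodule.smul_mem _ _ (Submodule.subset_span ⟨j, rfl⟩)
  · intro hy
    choose r hr using fun i => (Submodule.mem_span_range_iff_exists_fun _).1 (hy i)
    have hmem : (Matrix.of fun i j => (r i j : Quat u π)) ∈ integralMatrices u π l m :=
      fun i j => (r i j).2
    refine ⟨_, hmem, funext fun i => ?_⟩
    rw [← hr i]
    exact mkQ_row_mul _ hmem C i

/-- This is the index, among integral `h`, of those with `h * C` integral. -/
theorem card_map_mulRowsMod (C : Matrix (Fin m) (Fin n) (Quat u π)) :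
    Nat.card ((integralMatrices u π l m).map (mulRowsMod l C)) = Nat.card (rowSpan C) ^ l := by
  have e : (integralMatrices u π l m).map (mulRowsMod l C) ≃ (Fin l → rowSpan C) :=
    { toFun := fun y i => ⟨y.1 i, (mem_map_mulRowsMod C _).1 y.2 i⟩
      invFun := fun y => ⟨fun i => y i, (mem_map_mulRowsMod C _).2 fun i => (y i).2⟩
      left_inv := fun y => rfl
      right_inv := fun y => rfl }
  rw [Nat.card_congr e, Nat.card_fun, Nat.card_fin]

theorem finite_rowSpan [IsDiscreteValuationRing 𝒪[k]] [Finite 𝓀[k]] (hπ : Irreducible π)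
    (C : Matrix (Fin m) (Fin n) (Quat u π)) : Finite (rowSpan C) := by
  obtain ⟨t, ht⟩ := exists_pow_smul_mem_integralMatrices hπ C
  have hle : box π (matCoord u π 1 m) (fun _ => (t : ℤ)) ≤ (mulRowsMod 1 C).ker := by
    intro h hh
    rw [mem_box_matCoord] at hh
    refine rowsMod_eq_zero.2 ?_
    have := mul_mem_integralMatrices hh ht
    rwa [Matrix.smul_mul, Matrix.mul_smul, smul_smul, zpow_neg, zpow_natCast,
      inv_mul_cancel₀ (pow_ne_zero _ (prime_coe_ne_zero hπ)), one_smul] at this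
  have hfin := finite_map_box hπ matCoord_surjective hle t
  have h0 : box π (matCoord u π 1 m) (fun _ => (t : ℤ) - t) = integralMatrices u π 1 m := by
    ext h
    rw [mem_box_matCoord]
    simp
  rw [h0] at hfin
  have hne : Nat.card ((integralMatrices u π 1 m).map (mulRowsMod 1 C)) ≠ 0 := Nat.card_pos.ne'
  rw [card_map_mulRowsMod, pow_one] at hne
  exact Nat.finite_of_card_ne_zero hne

theorem conjTranspose_eq (X : Herm u π n) :
    X.1ᴴ = X.1 := X.2

theorem conjTranspose_mul_mul_eq (A : Herm u π m) (v : Matrix (Fin m) (Fin n) (Quat u π)) :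
    (vᴴ * A.1 * v)ᴴ = vᴴ * A.1 * v := by
  rw [Matrix.conjTranspose_mul, Matrix.conjTranspose_mul, Matrix.conjTranspose_conjTranspose,
    conjTranspose_eq, Matrix.mul_assoc]

/-- The two cross terms of the polarized form agree, which is the origin of the `2` in `traceChar`.
-/
theorem reTrace_symm (A : Herm u π m) (C : Herm u π n) (v h : Matrix (Fin m) (Fin n) (Quat u π)) :
    reTrace n (hᴴ * A.1 * v * C.1)
      = reTrace n (vᴴ * A.1 * h * C.1) := by
  rw [← reTrace_conjTranspose, Matrix.conjTranspose_mul, Matrix.conjTranspose_mul,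
    Matrix.conjTranspose_mul, Matrix.conjTranspose_conjTranspose, conjTranspose_eq,
    conjTranspose_eq, reTrace_mul_comm, Matrix.mul_assoc, Matrix.mul_assoc, Matrix.mul_assoc,
    Matrix.mul_assoc]

/-- The character `v ↦ ψ (2 Re tr (v* Y))`. -/
noncomputable def traceChar (ψ : AddChar k Circle) (Y : Matrix (Fin m) (Fin n) (Quat u π)) :
    AddChar (Matrix (Fin m) (Fin n) (Quat u π)) Circle where
  toFun v := ψ (2 * reTrace n (vᴴ * Y))
  map_zero_eq_one' := by simp
  map_add_eq_mul' v w := by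
    rw [Matrix.conjTranspose_add, Matrix.add_mul, map_add, mul_add, AddChar.map_add_eq_mul]

/-- Test against matrices with one nonzero entry `a • y`: varying `a` uses the conductor of `ψ`,
varying `y` the near self-duality of `O`. The factor `π` is lost because `Π² = π`. -/
theorem smul_mem_of_traceChar_eq_one (hu : IsUnit u) (h2 : IsUnit (2 : 𝒪[k]))
    {ψ : AddChar k Circle} (hψ : HasConductorIntegers ψ) {Y : Matrix (Fin m) (Fin n) (Quat u π)}
    (hY : ∀ v ∈ integralMatrices u π m n, traceChar ψ Y v = 1) :
    (π : k) • Y ∈ integralMatrices u π m n := by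
  intro i j
  refine smul_mem_integers_of_re_mul_mem hu h2 fun y hy => (hψ _).1 fun a ha => ?_
  have hv : Matrix.single i j (a • y) ∈ integralMatrices u π m n := by
    intro i' j'
    rw [Matrix.single_apply]
    split_ifs
    · exact smul_mem_integers ha hy
    · exact zero_mem _
  rw [← hY _ hv]
  change _ = ψ (2 * reTrace n _)
  congr 1
  rw [reTrace_mul_eq, Finset.sum_eq_single j, Finset.sum_eq_single i]
  · have : star (a • y) = a • star y := by ext <;> simp
    rw [Matrix.conjTranspose_apply, Matrix.single_apply, if_pos ⟨rfl, rfl⟩, this, smul_mul_assoc,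
      QuaternionAlgebra.re_smul, smul_eq_mul]
    ring
  · intro i' _ hi
    rw [Matrix.conjTranspose_apply, Matrix.single_apply, if_neg fun h => hi h.1.symm]
    simp
  · simp
  · intro j' _ hj
    refine Finset.sum_eq_zero fun i' _ => ?_
    rw [Matrix.conjTranspose_apply, Matrix.single_apply, if_neg fun h => hj h.2.symm]
    simp
  · simp

end GaussSum

/-! ### Bound and continuity of the Gauss sum. -/

section GaussSumBound

variable {k : Type*} [Field k] [ValuativeRel k] [TopologicalSpace k] [IsNonarchimedeanLocalField k]
  {u π : 𝒪[k]} {m n : ℕ}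

omit [TopologicalSpace k] [IsNonarchimedeanLocalField k] in
theorem two_ne_zero_of_isUnit (h2 : IsUnit (2 : 𝒪[k])) : (2 : k) ≠ 0 := by
  obtain ⟨w, hw⟩ := h2.exists_left_inv
  intro h
  have := congrArg Subtype.val hw
  have e : ((2 : 𝒪[k]) : k) = 2 := rfl
  rw [Subring.coe_mul, e, h, mul_zero] at this
  exact zero_ne_one this

omit [IsNonarchimedeanLocalField k] in
theorem gaussSum_eq (h2 : (2 : k) ≠ 0) (ψ : AddChar k Circle)
    (dv : Measure (Matrix (Fin m) (Fin n) (Quat u π))) (A : Herm u π m) (C : Herm u π n) :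
    gaussSum ψ dv A C = ∫ v in (integralMatrices u π m n : Set (Matrix (Fin m) (Fin n) (Quat u π))),
      (ψ (reTrace n (vᴴ * A.1 * v * C.1)) : ℂ) ∂dv := by
  simp only [gaussSum, pairing_eq_reTrace h2 (conjTranspose_mul_mul_eq A _) (conjTranspose_eq C)]

theorem continuous_quadratic_left {ψ : AddChar k Circle} (hψ : HasConductorIntegers ψ)
    (A : Matrix (Fin m) (Fin m) (Quat u π)) (C : Matrix (Fin n) (Fin n) (Quat u π)) :
    Continuous fun v : Matrix (Fin m) (Fin n) (Quat u π) => ψ (reTrace n (vᴴ * A * v * C)) := by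
  refine hψ.continuous.comp (continuous_re.comp (Continuous.matrix_trace ?_))
  fun_prop

/-- Weyl differencing with `R` the set of `h` for which `h * C'` is integral; its integral part has
index `|rowSpan C'| ^ m` in a group of measure `1`. -/
theorem norm_gaussSum_sq_le (hu : ¬ IsSquare (IsLocalRing.residue 𝒪[k] u)) (hπ : Irreducible π)
    {ψ : AddChar k Circle} (hψ : HasConductorIntegers ψ)
    (dv : Measure (Matrix (Fin m) (Fin n) (Quat u π))) [dv.IsAddHaarMeasure]
    (hdv : dv (integralMatrices u π m n) = 1) (A : Herm u π m)
    {A' : Matrix (Fin m) (Fin m) (Quat u π)} (hA : A' * A.1 = 1) {a : ℕ}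
    (ha : (π : k) ^ a • A' ∈ integralMatrices u π m m) (C : Herm u π n) :
    ‖gaussSum ψ dv A C‖ ^ 2 ≤ ((Nat.card (rowSpan ((π : k) ^ (a + 1) • C.1)) : ℝ) ^ m)⁻¹ := by
  have h2u := isUnit_two_of_residue_not_isSquare hu
  have h2 := two_ne_zero_of_isUnit h2u
  set C' := (π : k) ^ (a + 1) • C.1 with hC'
  set R := (mulRowsMod m C').ker with hR
  have hRmem : ∀ h, h ∈ R ↔ h * C' ∈ integralMatrices u π m n := fun h => rowsMod_eq_zero
  have hRo : IsOpen (R : Set (Matrix (Fin m) (Fin n) (Quat u π))) := by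
    have : (R : Set (Matrix (Fin m) (Fin n) (Quat u π)))
        = (fun h => h * C') ⁻¹' (integralMatrices u π m n : Set _) := Set.ext hRmem
    rw [this]
    exact isOpen_integralMatrices.preimage (by fun_prop)
  have hcont : Continuous fun v : Matrix (Fin m) (Fin n) (Quat u π) =>
      ψ (reTrace n (vᴴ * A.1 * v * C.1)) :=
    continuous_quadratic_left hψ A.1 C.1
  have hbound := norm_sq_setIntegral_quadratic_le dv (K := integralMatrices u π m n)
    isClopen_integralMatrices isCompact_integralMatrices
    (f := fun v => ψ (reTrace n (vᴴ * A.1 * v * C.1)))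
    (β := fun h => traceChar ψ (A.1 * h * C.1)) (R := R)
    hcont ?_ hRo.measurableSet ?_
  · rw [gaussSum_eq h2]
    refine hbound.trans (le_of_eq ?_)
    have hfin := finite_rowSpan hπ C'
    have hidx : R.relIndex (integralMatrices u π m n) = Nat.card (rowSpan C') ^ m := by
      rw [hR, AddSubgroup.relIndex_ker, card_map_mulRowsMod]
    have hne : (R ⊓ integralMatrices u π m n).relIndex (integralMatrices u π m n) ≠ 0 := by
      rw [AddSubgroup.inf_relIndex_right, hidx]
      exact pow_ne_zero _ Nat.card_pos.ne'
    have hm := measure_eq_relIndex_mul dv (H := R ⊓ integralMatrices u π m n) inf_le_right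
      (hRo.inter isOpen_integralMatrices).measurableSet hne
    rw [AddSubgroup.inf_relIndex_right, hidx, hdv] at hm
    have hm' := congrArg ENNReal.toReal hm
    rw [ENNReal.toReal_mul, ENNReal.toReal_one, ENNReal.toReal_natCast] at hm'
    rw [Measure.real, hdv, ENNReal.toReal_one, one_mul, Measure.real, Set.inter_comm]
    rw [eq_comm] at hm'
    have := eq_inv_of_mul_eq_one_right hm'
    rw [Nat.cast_pow] at this
    exact this
  · intro v h
    change _ = _ * _ * ψ (2 * reTrace n (vᴴ * (A.1 * h * C.1)))
    rw [← AddChar.map_add_eq_mul, ← AddChar.map_add_eq_mul]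
    congr 1
    have e := reTrace_symm A C v h
    rw [Matrix.conjTranspose_add, Matrix.add_mul, Matrix.add_mul, Matrix.mul_add, Matrix.mul_add,
      Matrix.add_mul, Matrix.add_mul, Matrix.add_mul, map_add, map_add, map_add, e]
    simp only [Matrix.mul_assoc]
    ring
  · intro h _ hhR
    -- If the polar character is trivial, `π A h C` is integral. Multiplying by `π ^ a A'`, with
    -- `A'` the inverse of `A`, shows that `π ^ (a + 1) h C` is integral, so `h ∈ R`.
    by_contra! hall
    refine hhR ((hRmem h).2 ?_)
    have h1 := smul_mem_of_traceChar_eq_one (isUnit_of_residue_not_isSquare hu) h2u hψ hall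
    have h3 := mul_mem_integralMatrices ha h1
    rwa [Matrix.smul_mul, Matrix.mul_smul, smul_smul, ← pow_succ, ← Matrix.mul_assoc,
      ← Matrix.mul_assoc, hA, Matrix.one_mul, ← Matrix.mul_smul] at h3

theorem exists_enorm_gaussSum_le (hu : ¬ IsSquare (IsLocalRing.residue 𝒪[k] u))
    (hπ : Irreducible π) {ψ : AddChar k Circle} (hψ : HasConductorIntegers ψ) (hmn : 6 * n ≤ m)
    (dv : Measure (Matrix (Fin m) (Fin n) (Quat u π))) [dv.IsAddHaarMeasure]
    (hdv : dv (integralMatrices u π m n) = 1) (A : Herm u π m) (hA : A ∈ nondegHerm u π m) :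
    ∃ a : ℕ, ∀ C : Herm u π n,
      ‖gaussSum ψ dv A C‖ₑ ≤ invCard (rowSpan ((π : k) ^ a • C.1)) ^ (3 * n) := by
  obtain ⟨A', hA'⟩ := hA.exists_left_inv
  obtain ⟨a, ha⟩ := exists_pow_smul_mem_integralMatrices hπ A'
  refine ⟨a + 1, fun C => ?_⟩
  have h := norm_gaussSum_sq_le hu hπ hψ dv hdv A hA' ha C
  have hfin := finite_rowSpan hπ ((π : k) ^ (a + 1) • C.1)
  set N := Nat.card (rowSpan ((π : k) ^ (a + 1) • C.1)) with hN
  have hN1 : (1 : ℝ) ≤ N := by exact_mod_cast Nat.card_pos (α := rowSpan ((π : k) ^ (a + 1) • C.1))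
  have h' : ‖gaussSum ψ dv A C‖ ≤ ((N : ℝ) ^ (3 * n))⁻¹ := by
    refine le_of_sq_le_sq (h.trans ?_) (by positivity)
    rw [inv_pow, ← pow_mul]
    exact inv_anti₀ (by positivity) (pow_le_pow_right₀ hN1 (by omega))
  have e : invCard (rowSpan ((π : k) ^ (a + 1) • C.1)) ^ (3 * n)
      = ENNReal.ofReal (((N : ℝ) ^ (3 * n))⁻¹) := by
    rw [invCard, ENat.card_eq_coe_natCard, ← hN, ENNReal.ofReal_inv_of_pos (by positivity),
      ENNReal.ofReal_pow (by positivity), ENNReal.ofReal_natCast, ENat.toENNReal_coe,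
      ENNReal.inv_pow]
  rw [e, ← ofReal_norm]
  exact ENNReal.ofReal_le_ofReal h'

/-- If `π ^ s A` is integral, a change of `C` by `π ^ s V_n(O)` alters the phase by an integer of
`k`, so the Gauss sum is locally constant. -/
theorem continuous_gaussSum (hu : ¬ IsSquare (IsLocalRing.residue 𝒪[k] u)) (hπ : Irreducible π)
    {ψ : AddChar k Circle} (hψ : HasConductorIntegers ψ)
    (dv : Measure (Matrix (Fin m) (Fin n) (Quat u π))) (A : Herm u π m) :
    Continuous (gaussSum (n := n) ψ dv A) := by
  have h2 := two_ne_zero_of_isUnit (isUnit_two_of_residue_not_isSquare hu)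
  obtain ⟨s, hs⟩ := exists_pow_smul_mem_integralMatrices hπ A.1
  have h0 : (π : k) ^ s ≠ 0 := pow_ne_zero _ (prime_coe_ne_zero hπ)
  let U : AddSubgroup (Herm u π n) :=
    { carrier := {C | ((π : k) ^ s)⁻¹ • C.1 ∈ integralMatrices u π n n}
      zero_mem' := by simp
      add_mem' := fun {C D} hC hD => by
        simpa only [Set.mem_ofPred_eq, AddSubgroup.coe_add, smul_add] using add_mem hC hD
      neg_mem' := fun {C} hC => by
        simpa only [Set.mem_ofPred_eq, AddSubgroup.coe_neg, smul_neg, neg_mem_iff] using hC }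
  have hU : IsOpen (U : Set (Herm u π n)) :=
    isOpen_integralMatrices.preimage (continuous_subtype_val.const_smul ((π : k) ^ s)⁻¹)
  refine continuous_of_eq_on_cosets hU fun C D hD => ?_
  rw [gaussSum_eq h2, gaussSum_eq h2]
  refine setIntegral_congr_fun isOpen_integralMatrices.measurableSet fun v hv => ?_
  simp only [AddSubgroup.coe_add, Matrix.mul_add, map_add, AddChar.map_add_eq_mul]
  have : reTrace n (vᴴ * A.1 * v * D.1) ∈ 𝒪[k] := by
    have e : vᴴ * A.1 * v * D.1
        = vᴴ * ((π : k) ^ s • A.1) * v * (((π : k) ^ s)⁻¹ • D.1) := by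
      rw [Matrix.mul_smul, Matrix.mul_smul, Matrix.smul_mul, Matrix.smul_mul, smul_smul,
        inv_mul_cancel₀ h0, one_smul]
    rw [e]
    exact reTrace_mem (mul_mem_integralMatrices (mul_mem_integralMatrices
      (mul_mem_integralMatrices (conjTranspose_mem_integralMatrices hv) hs) hv) hD)
  rw [hψ.apply_eq_one this, mul_one]

end GaussSumBound

/-! ### Volumes of coordinate lattices. -/

section BoxMeasure

variable {k : Type*} [Field k] [ValuativeRel k] [IsDiscreteValuationRing 𝒪[k]] [Finite 𝓀[k]]

theorem measureReal_box {ι W : Type*} [Fintype ι] [AddCommGroup W] [TopologicalSpace W]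
    [IsTopologicalAddGroup W] [MeasurableSpace W] [BorelSpace W] (μ : Measure W)
    [μ.IsAddLeftInvariant] {π : 𝒪[k]} (hπ : Irreducible π) {φ : W →+ (ι → k)}
    (hφ : Function.Surjective φ)
    (hm : ∀ a : ι → ℤ, MeasurableSet (box π φ a : Set W)) (h1 : μ (box π φ 0 : Set W) = 1)
    (a : ι → ℤ) : μ.real (box π φ a : Set W) = (residueCard k : ℝ) ^ (-∑ i, a i) := by
  have hq : residueCard k ≠ 0 := Nat.card_pos.ne'
  have hq' : (residueCard k : ℝ) ≠ 0 := by exact_mod_cast hq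
  have step : ∀ (a : ι → ℤ) (d : ι → ℕ), μ.real (box π φ a : Set W)
      = (residueCard k : ℝ) ^ (∑ i, (d i : ℤ)) * μ.real (box π φ (fun i => a i + d i) : Set W) := by
    intro a d
    have hidx := box_relIndex hπ φ hφ a d
    have := measure_eq_relIndex_mul μ (box_mono hπ φ (fun i => by simp : a ≤ fun i => a i + d i))
      (hm _) (by rw [hidx]; exact pow_ne_zero _ hq)
    rw [hidx] at this
    rw [Measure.real, this, ENNReal.toReal_mul, ENNReal.toReal_natCast, Nat.cast_pow,
      ← Nat.cast_sum, zpow_natCast, Measure.real]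
  -- The given box and the unit box are compared through their intersection, whose exponents are the
  -- positive parts of the `a i`.
  have h0 := step 0 (fun i => (a i).toNat)
  have h2 := step a (fun i => (-a i).toNat)
  have e : (fun i => a i + ((-a i).toNat : ℤ)) = fun i => (0 : ι → ℤ) i + ((a i).toNat : ℤ) := by
    ext i
    simp only [Pi.zero_apply]
    omega
  rw [e] at h2
  rw [Measure.real, h1, ENNReal.toReal_one] at h0
  have h3 : -∑ i, a i = ∑ i, ((-a i).toNat : ℤ) - ∑ i, ((a i).toNat : ℤ) := by
    rw [← Finset.sum_neg_distrib, ← Finset.sum_sub_distrib]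
    exact Finset.sum_congr rfl fun i _ => by omega
  rw [h2, h3, zpow_sub₀ hq', eq_div_iff (zpow_ne_zero _ hq'), mul_assoc, mul_comm (μ.real _), ← h0,
    mul_one]

end BoxMeasure

/-! ### Coordinates on hermitian matrices and duality of lattices. -/

section HermCoord

variable {k : Type*} [Field k] [ValuativeRel k] {u π : 𝒪[k]} {n : ℕ}

/-- Index set for the coordinates of hermitian matrices: the diagonal entries and the four
coordinates of each entry above the diagonal. -/
abbrev HermIndex (n : ℕ) : Type := Fin n ⊕ ({p : Fin n × Fin n // p.1 < p.2} × Fin 4)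

theorem two_mul_card_lt (n : ℕ) :
    2 * Fintype.card {p : Fin n × Fin n // p.1 < p.2} = n * (n - 1) := by
  have h1 : Fintype.card {p : Fin n × Fin n // p.1 < p.2}
      = ∑ i : Fin n, (i : ℕ) := by
    rw [Fintype.card_subtype, Finset.card_filter, Fintype.sum_prod_type, Finset.sum_comm]
    refine Finset.sum_congr rfl fun j _ => ?_
    rw [← Finset.card_filter, Finset.filter_gt_eq_Iio, Fin.card_Iio]
  rw [h1, Fin.sum_univ_eq_sum_range (fun i => i) n, mul_comm, Finset.sum_range_id_mul_two]

theorem card_hermIndex (n : ℕ) : (Fintype.card (HermIndex n) : ℤ) = n * (2 * n - 1) := by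
  have h := two_mul_card_lt n
  have h' : 2 * (Fintype.card {p : Fin n × Fin n // p.1 < p.2} : ℤ) = n * (n - 1) := by
    rcases n with _ | n
    · simp at h ⊢
    · rw [Nat.add_sub_cancel] at h
      push_cast
      rw [add_sub_cancel_right]
      exact_mod_cast h
  rw [Fintype.card_sum, Fintype.card_prod, Fintype.card_fin, Fintype.card_fin]
  push_cast
  linear_combination 2 * h'

/-- The coordinates of a hermitian matrix. -/
def hermCoord (u π : 𝒪[k]) (n : ℕ) : Herm u π n →+ (HermIndex n → k) where
  toFun X := Sum.elim (fun i => (X.1 i i).re) fun p => quatCoord u π (X.1 p.1.1.1 p.1.1.2) p.2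
  map_zero' := by ext (i | p) <;> simp
  map_add' X Y := by ext (i | p) <;> simp

theorem hermCoord_inl (X : Herm u π n) (i : Fin n) : hermCoord u π n X (Sum.inl i) = (X.1 i i).re :=
  rfl

theorem hermCoord_inr (X : Herm u π n) (p : {p : Fin n × Fin n // p.1 < p.2}) (c : Fin 4) :
    hermCoord u π n X (Sum.inr (p, c)) = quatCoord u π (X.1 p.1.1 p.1.2) c := rfl

theorem hermCoord_surjective : Function.Surjective (hermCoord u π n) := by
  intro y
  choose z hz using fun p : {p : Fin n × Fin n // p.1 < p.2} =>
    quatCoord_surjective (u := u) (π := π) fun c => y (Sum.inr (p, c))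
  let X : Matrix (Fin n) (Fin n) (Quat u π) := Matrix.of fun i j =>
    if h : i < j then z ⟨(i, j), h⟩ else
      if h : j < i then star (z ⟨(j, i), h⟩) else ⟨y (Sum.inl i), 0, 0, 0⟩
  have hX : IsSelfAdjoint X := by
    ext1 i j
    change star (X j i) = X i j
    simp only [X, Matrix.of_apply]
    rcases lt_trichotomy i j with h | h | h
    · rw [dif_neg h.not_gt, dif_pos h, dif_pos h, star_star]
    · subst h
      simp only [lt_irrefl, dif_neg, not_false_eq_true]
      ext <;> simp
    · rw [dif_pos h, dif_neg h.not_gt, dif_pos h]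
  refine ⟨⟨X, hX⟩, ?_⟩
  ext (i | ⟨p, c⟩)
  · rw [hermCoord_inl]
    simp [X]
  · rw [hermCoord_inr]
    simp only [X, Matrix.of_apply]
    rw [dif_pos p.2]
    exact congrFun (hz p) c

theorem mem_box_hermCoord (h2 : (2 : k) ≠ 0) {a : ℤ} {X : Herm u π n} :
    X ∈ box π (hermCoord u π n) (fun _ => a) ↔ (π : k) ^ (-a) • X.1 ∈ integralMatrices u π n n := by
  constructor
  · intro h
    have hlt : ∀ i j, i < j → (π : k) ^ (-a) • X.1 i j ∈ integers u π := by
      intro i j hij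
      rw [mem_integers_iff]
      intro c
      rw [quatCoord_smul]
      exact h (Sum.inr (⟨(i, j), hij⟩, c))
    intro i j
    rw [Matrix.smul_apply]
    rcases lt_trichotomy i j with hij | rfl | hij
    · exact hlt i j hij
    · have hi := h (Sum.inl i)
      rw [hermCoord_inl] at hi
      rw [diag_eq_re h2 (conjTranspose_eq X) i]
      refine ⟨hi, ?_, ?_, ?_⟩ <;> simp
    · have e : X.1 i j = star (X.1 j i) := (congrFun (congrFun (conjTranspose_eq X) i) j).symm
      have e' : (π : k) ^ (-a) • X.1 i j = star ((π : k) ^ (-a) • X.1 j i) := by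
        rw [e]; ext <;> simp
      rw [e']
      exact star_mem_integers (hlt j i hij)
  · rintro h (i | ⟨p, c⟩)
    · exact (h i i).1
    · rw [hermCoord_inr]
      have := (mem_integers_iff.1 (h p.1.1 p.1.2)) c
      rwa [Matrix.smul_apply, quatCoord_smul] at this

/-- The exponents of `π` in the weights of the pairing in coordinates. -/
def pairingExponent (n : ℕ) : HermIndex n → ℕ :=
  Sum.elim (fun _ => 0) fun p => ![0, 0, 1, 1] p.2

/-- The unit parts of the weights of the pairing in coordinates. -/
noncomputable def pairingUnit (u : 𝒪[k]) (n : ℕ) : HermIndex n → 𝒪[k] :=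
  Sum.elim (fun _ => 1) fun p => ![2, -2 * u, -2, 2 * u] p.2

theorem isUnit_pairingUnit (hu : IsUnit u) (h2 : IsUnit (2 : 𝒪[k])) (κ : HermIndex n) :
    IsUnit (pairingUnit u n κ) := by
  rcases κ with i | ⟨p, c⟩
  · exact isUnit_one
  · change IsUnit (![2, -2 * u, -2, 2 * u] c)
    fin_cases c
    · exact h2
    · exact h2.neg.mul hu
    · exact h2.neg
    · exact h2.mul hu

/-- The source of `q ^ (n (n - 1))`: each of the `n (n - 1) / 2` entries above the diagonal has two
coordinates, those at `Π` and `εΠ`, of weight divisible by `π`. -/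
theorem sum_pairingExponent (n : ℕ) : ∑ κ, pairingExponent n κ = n * (n - 1) := by
  rw [← two_mul_card_lt, Fintype.sum_sum_type, Fintype.sum_prod_type]
  simp [pairingExponent, Fin.sum_univ_four, mul_comm]

/-- The basis `1, ε, Π, εΠ` is orthogonal for `Trd (x y*)`, with values `2, -2u, -2π, 2uπ`, so the
pairing is diagonal in coordinates. -/
theorem pairing_eq_sum (X Y : Herm u π n) :
    pairing X.1 Y.1 = ∑ κ, (pairingUnit u n κ : k) * (π : k) ^ pairingExponent n κ *
      (hermCoord u π n X κ * hermCoord u π n Y κ) := by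
  rw [pairing, Fintype.sum_sum_type]
  congr 1
  · exact Finset.sum_congr rfl fun i _ => by
      simp [pairingUnit, pairingExponent, hermCoord_inl]
  · have h1 : ∀ i j, trd (X.1 i j * Y.1 j i) = ∑ c : Fin 4,
        ((![2, -2 * u, -2, 2 * u] c : 𝒪[k]) : k) * (π : k) ^ (![0, 0, 1, 1] c : ℕ) *
          (quatCoord u π (X.1 i j) c * quatCoord u π (Y.1 i j) c) := by
      intro i j
      have e : Y.1 j i = star (Y.1 i j) := (congrFun (congrFun (conjTranspose_eq Y) j) i).symm
      have e2 : ((2 : 𝒪[k]) : k) = 2 := rfl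
      rw [e, trd, Fin.sum_univ_four]
      simp [quatCoord, e2]
      ring
    simp_rw [h1, Finset.sum_filter]
    rw [Fintype.sum_prod_type, ← Fintype.sum_prod_type' (f := fun i j => if i < j then _ else _),
      ← Finset.sum_filter, ← Finset.sum_subtype_eq_sum_filter]
    refine Finset.sum_congr ?_ fun p _ => rfl
    ext p
    simp

/-- As the pairing is diagonal with weights a unit times `π ^ pairingExponent`, duality of lattices
is checked one coordinate at a time. -/
theorem pairing_trivial_iff (hu : IsUnit u) (h2 : IsUnit (2 : 𝒪[k])) (hπ : Irreducible π)
    {ψ : AddChar k Circle} (hψ : HasConductorIntegers ψ) (X : Herm u π n) (j : ℤ) :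
    (∀ C ∈ box π (hermCoord u π n) (fun κ => j - pairingExponent n κ), ψ (pairing X.1 C.1) = 1) ↔
      X ∈ box π (hermCoord u π n) (fun _ => -j) := by
  have h0 := prime_coe_ne_zero hπ
  constructor
  · intro h κ
    rw [neg_neg]
    obtain ⟨w, hw⟩ := (isUnit_pairingUnit hu h2 κ).exists_left_inv
    have key : (pairingUnit u n κ : k) * ((π : k) ^ j * hermCoord u π n X κ) ∈ 𝒪[k] := by
      refine (hψ _).1 fun a ha => ?_
      obtain ⟨C, hC⟩ := hermCoord_surjective (u := u) (π := π)
        (Pi.single κ (a * (π : k) ^ (j - pairingExponent n κ)))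
      rw [← h C ?_, pairing_eq_sum, Finset.sum_eq_single κ]
      · rw [hC, Pi.single_eq_same, zpow_sub₀ h0, zpow_natCast]
        congr 1
        field_simp
      · intro κ' _ hne
        rw [hC, Pi.single_eq_of_ne hne, mul_zero, mul_zero]
      · simp
      · intro κ'
        rw [hC]
        by_cases hκ : κ' = κ
        · subst hκ
          rw [Pi.single_eq_same, mul_left_comm, ← zpow_add₀ h0]
          simpa using ha
        · rw [Pi.single_eq_of_ne hκ]
          simp
    have := mul_mem w.2 key
    rwa [← mul_assoc, ← Subring.coe_mul, hw, Subring.coe_one, one_mul] at this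
  · intro h C hC
    refine hψ.apply_eq_one ?_
    rw [pairing_eq_sum]
    refine sum_mem fun κ _ => ?_
    have h3 := mul_mem (pairingUnit u n κ).2 (mul_mem (h κ) (hC κ))
    have e : (pairingUnit u n κ : k) * (π : k) ^ pairingExponent n κ *
        (hermCoord u π n X κ * hermCoord u π n C κ) = (pairingUnit u n κ : k) *
        ((π : k) ^ (-(-j)) * hermCoord u π n X κ *
          ((π : k) ^ (-(j - pairingExponent n κ)) * hermCoord u π n C κ)) := by
      rw [neg_neg, neg_sub, zpow_sub₀ h0, zpow_natCast]
      field_simp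
    rw [e]
    exact h3

end HermCoord

/-! ### Lattices of hermitian matrices are open and compact. -/

section HermTopology

variable {k : Type*} [Field k] [ValuativeRel k] [TopologicalSpace k] [IsNonarchimedeanLocalField k]
  {u π : 𝒪[k]} {n : ℕ}

theorem isOpen_box_hermCoord (a : HermIndex n → ℤ) :
    IsOpen (box π (hermCoord u π n) a : Set (Herm u π n)) := by
  have : (box π (hermCoord u π n) a : Set (Herm u π n))
      = ⋂ κ, (fun X => (π : k) ^ (-a κ) * hermCoord u π n X κ) ⁻¹' (𝒪[k] : Set k) := by
    ext X
    simp only [Set.mem_iInter]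
    rfl
  rw [this]
  refine isOpen_iInter_of_finite fun κ => isOpen_valuativeIntegers.preimage ?_
  refine continuous_const.mul ?_
  rcases κ with i | ⟨p, c⟩
  · exact continuous_re.comp (continuous_subtype_val.matrix_elem i i)
  · have h := continuous_quat_iff.1
      ((continuous_subtype_val (p := fun X => X ∈ Herm u π n)).matrix_elem p.1.1 p.1.2)
    obtain ⟨h1, h2, h3, h4⟩ := h
    fin_cases c
    exacts [h1, h2, h3, h4]

theorem isClopen_box_hermCoord (a : HermIndex n → ℤ) :
    IsClopen (box π (hermCoord u π n) a : Set (Herm u π n)) :=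
  ⟨AddSubgroup.isClosed_of_isOpen _ (isOpen_box_hermCoord a), isOpen_box_hermCoord a⟩

theorem t2Space_localField : T2Space k := by
  refine IsTopologicalAddGroup.t2Space_of_zero_sep fun x hx => ?_
  refine ⟨{y | valuation k y < valuation k x}, ?_, fun h => lt_irrefl (valuation k x) h⟩
  exact (IsValuativeTopology.hasBasis_nhds_zero' k).mem_of_mem (by simpa using hx)

theorem t2Space_quat : T2Space (Quat u π) := by
  have := t2Space_localField (k := k)
  exact T2Space.of_injective_continuous
    (QuaternionAlgebra.equivProd (u : k) 0 (π : k)).injective continuous_induced_dom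

theorem isCompact_box_hermCoord (h2 : (2 : k) ≠ 0) (hπ : Irreducible π) (a : HermIndex n → ℤ) :
    IsCompact (box π (hermCoord u π n) a : Set (Herm u π n)) := by
  have h0 := prime_coe_ne_zero hπ
  have := t2Space_quat (u := u) (π := π)
  have hT2 : T2Space (Matrix (Fin n) (Fin n) (Quat u π)) :=
    inferInstanceAs (T2Space (Fin n → Fin n → Quat u π))
  have hclosed : IsClosed {X : Matrix (Fin n) (Fin n) (Quat u π) | X ∈ Herm u π n} :=
    isClosed_eq (f := fun X : Matrix (Fin n) (Fin n) (Quat u π) => Xᴴ)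
      continuous_id.matrix_conjTranspose continuous_id
  obtain ⟨N, hN⟩ : ∃ N : ℤ, ∀ κ, N ≤ a κ :=
    (Set.finite_range a).bddBelow.imp fun N hN κ => hN ⟨κ, rfl⟩
  have hc := hclosed.isClosedEmbedding_subtypeVal.isCompact_preimage
    (isCompact_smul_mem_integralMatrices (u := u) (π := π) (m := n) (n := n)
      (zpow_ne_zero (-N) h0))
  refine hc.of_isClosed_subset (isClopen_box_hermCoord a).isClosed fun X hX => ?_
  exact (mem_box_hermCoord h2).1 (box_mono hπ _ hN hX)

end HermTopology

/-! ### Approximate representations and their count. -/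

section Representations

variable {k : Type*} [Field k] [ValuativeRel k] {u π : 𝒪[k]} {m n : ℕ}

theorem mem_pow_smul_integralMatrices (hπ : Irreducible π) {ℓ : ℕ}
    {X : Matrix (Fin m) (Fin n) (Quat u π)} :
    X ∈ (π : k) ^ ℓ • integralMatrices u π m n ↔
      ((π : k) ^ ℓ)⁻¹ • X ∈ integralMatrices u π m n :=
  AddSubgroup.mem_pointwise_smul_iff_inv_smul_mem₀ (pow_ne_zero _ (prime_coe_ne_zero hπ)) _ _

theorem pow_smul_integralMatrices_eq_box (hπ : Irreducible π) (ℓ : ℕ) :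
    (π : k) ^ ℓ • integralMatrices u π m n = box π (matCoord u π m n) (fun _ => (ℓ : ℤ)) := by
  ext X
  rw [mem_pow_smul_integralMatrices hπ, mem_box_matCoord, zpow_neg, zpow_natCast]

theorem pow_smul_integralMatrices_le (hπ : Irreducible π) (ℓ : ℕ) :
    (π : k) ^ ℓ • integralMatrices u π m n ≤ integralMatrices u π m n := by
  intro X hX
  rw [mem_pow_smul_integralMatrices hπ] at hX
  have := smul_mem_integralMatrices (pow_mem π.2 ℓ) hX
  rwa [smul_inv_smul₀ (pow_ne_zero _ (prime_coe_ne_zero hπ))] at this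

theorem integralMatrices_eq_box :
    integralMatrices u π m n = box π (matCoord u π m n) 0 := by
  ext X
  have := mem_box_matCoord (a := 0) (X := X)
  rw [neg_zero, zpow_zero, one_smul] at this
  exact this.symm

/-- The integral matrices `v` with `v* A v ≡ B` modulo `π ^ ℓ`. -/
def approxRepresentations (B : Matrix (Fin n) (Fin n) (Quat u π))
    (A : Matrix (Fin m) (Fin m) (Quat u π)) (ℓ : ℕ) : Set (Matrix (Fin m) (Fin n) (Quat u π)) :=
  {v | v ∈ integralMatrices u π m n ∧ vᴴ * A * v - B ∈ (π : k) ^ ℓ • integralMatrices u π n n}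

/-- Thus the condition depends only on `v` modulo `π ^ ℓ`, so its measure counts residue classes. -/
theorem add_mem_approxRepresentations (hπ : Irreducible π) {B : Matrix (Fin n) (Fin n) (Quat u π)}
    {A : Matrix (Fin m) (Fin m) (Quat u π)} (hA : A ∈ integralMatrices u π m m) {ℓ : ℕ}
    {v h : Matrix (Fin m) (Fin n) (Quat u π)} (hv : v ∈ approxRepresentations B A ℓ)
    (hh : h ∈ (π : k) ^ ℓ • integralMatrices u π m n) : v + h ∈ approxRepresentations B A ℓ := by
  have hhK := pow_smul_integralMatrices_le hπ ℓ hh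
  refine ⟨add_mem hv.1 hhK, ?_⟩
  have e : (v + h)ᴴ * A * (v + h) - B
      = (vᴴ * A * v - B) + (((v + h)ᴴ * A) * h + hᴴ * (A * v)) := by
    rw [Matrix.conjTranspose_add]
    simp only [Matrix.add_mul, Matrix.mul_add, Matrix.mul_assoc]
    abel
  rw [e]
  refine add_mem hv.2 (add_mem ?_ ?_)
  · rw [mem_pow_smul_integralMatrices hπ] at hh ⊢
    rw [← Matrix.mul_smul]
    exact mul_mem_integralMatrices (mul_mem_integralMatrices
      (conjTranspose_mem_integralMatrices (add_mem hv.1 hhK)) hA) hh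
  · rw [mem_pow_smul_integralMatrices hπ] at hh ⊢
    have e' : ((π : k) ^ ℓ)⁻¹ • (hᴴ * (A * v)) = (((π : k) ^ ℓ)⁻¹ • h)ᴴ * (A * v) := by
      have : (((π : k) ^ ℓ)⁻¹ • h)ᴴ = ((π : k) ^ ℓ)⁻¹ • hᴴ := by
        ext i j <;> simp [Matrix.conjTranspose_apply]
      rw [this, Matrix.smul_mul]
    rw [e']
    exact mul_mem_integralMatrices (conjTranspose_mem_integralMatrices hh)
      (mul_mem_integralMatrices hA hv.1)

/-- The count is moved to a quotient of the whole matrix group, where the measure of a preimage is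
available. -/
theorem repCount_eq_card (B : Matrix (Fin n) (Fin n) (Quat u π))
    (A : Matrix (Fin m) (Fin m) (Quat u π)) (ℓ : ℕ) :
    repCount B A ℓ = Nat.card (QuotientAddGroup.mk' ((π : k) ^ ℓ • integralMatrices u π m n) ''
      approxRepresentations B A ℓ) := by
  set H := (π : k) ^ ℓ • integralMatrices u π m n
  let g : integralMatrices u π m n ⧸ H.addSubgroupOf (integralMatrices u π m n) →+
      Matrix (Fin m) (Fin n) (Quat u π) ⧸ H :=
    QuotientAddGroup.map _ _ (integralMatrices u π m n).subtype le_rfl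
  have hg : Function.Injective g := by
    rw [injective_iff_map_eq_zero]
    intro x hx
    obtain ⟨v, rfl⟩ := QuotientAddGroup.mk_surjective x
    have hx' : (QuotientAddGroup.mk (v : Matrix (Fin m) (Fin n) (Quat u π)) :
      Matrix (Fin m) (Fin n) (Quat u π) ⧸ H) = 0 := hx
    rw [QuotientAddGroup.eq_zero_iff] at hx'
    rwa [QuotientAddGroup.eq_zero_iff, AddSubgroup.mem_addSubgroupOf]
  refine Nat.card_congr (Equiv.ofBijective (fun w => ⟨g w.1, ?_⟩) ⟨?_, ?_⟩)
  · obtain ⟨w, v, rfl, hv⟩ := w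
    exact ⟨v, ⟨v.2, hv⟩, rfl⟩
  · intro w w' h
    exact Subtype.ext (hg (Subtype.mk.inj h))
  · rintro ⟨_, v, hv, rfl⟩
    exact ⟨⟨QuotientAddGroup.mk ⟨v, hv.1⟩, ⟨v, hv.1⟩, rfl, hv.2⟩, rfl⟩

end Representations

/-! ### Measure of the approximate representations; absolute convergence. -/

section LocalField

variable {k : Type*} [Field k] [ValuativeRel k] [TopologicalSpace k] [IsNonarchimedeanLocalField k]
  {u π : 𝒪[k]} {m n : ℕ}

theorem isOpen_box_matCoord (hπ : Irreducible π) (a : (Fin m × Fin n) × Fin 4 → ℤ) :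
    IsOpen (box π (matCoord u π m n) a : Set (Matrix (Fin m) (Fin n) (Quat u π))) := by
  obtain ⟨N, hN⟩ : ∃ N : ℤ, ∀ κ, a κ ≤ N :=
    (Set.finite_range a).bddAbove.imp fun N hN κ => hN ⟨κ, rfl⟩
  refine AddSubgroup.isOpen_mono (box_mono hπ _ hN) ?_
  have : (box π (matCoord u π m n) (fun _ => N) : Set (Matrix (Fin m) (Fin n) (Quat u π)))
      = (fun X => (π : k) ^ (-N) • X) ⁻¹' (integralMatrices u π m n : Set _) :=
    Set.ext fun X => mem_box_matCoord
  change IsOpen (box π (matCoord u π m n) (fun _ => N) : Set (Matrix (Fin m) (Fin n) (Quat u π)))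
  rw [this]
  exact isOpen_integralMatrices.preimage (continuous_const_smul _)

theorem measure_approxRepresentations (hπ : Irreducible π)
    (dv : Measure (Matrix (Fin m) (Fin n) (Quat u π))) [dv.IsAddHaarMeasure]
    (hdv : dv (integralMatrices u π m n) = 1) (B : Matrix (Fin n) (Fin n) (Quat u π))
    {A : Matrix (Fin m) (Fin m) (Quat u π)} (hA : A ∈ integralMatrices u π m m) (ℓ : ℕ) :
    MeasurableSet (approxRepresentations B A ℓ) ∧ dv.real (approxRepresentations B A ℓ)
      = (repCount B A ℓ : ℝ) * (residueCard k : ℝ) ^ (-((ℓ : ℤ) * (4 * m * n))) := by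
  set H := (π : k) ^ ℓ • integralMatrices u π m n with hH
  set g := QuotientAddGroup.mk' H with hg
  have hbox := pow_smul_integralMatrices_eq_box (u := u) (m := m) (n := n) hπ ℓ
  have hker : g.ker = H := QuotientAddGroup.ker_mk' H
  have hsurj : Function.Surjective g := QuotientAddGroup.mk'_surjective H
  have hle : box π (matCoord u π m n) (fun _ => (ℓ : ℤ)) ≤ g.ker := by rw [hker, hH, hbox]
  have hcount : Countable (Matrix (Fin m) (Fin n) (Quat u π) ⧸ H) :=
    countable_of_box_le_ker hπ matCoord_surjective hle hsurj
  have hkm : MeasurableSet (g.ker : Set (Matrix (Fin m) (Fin n) (Quat u π))) := by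
    rw [hker, hH, hbox]
    exact (isOpen_box_matCoord hπ _).measurableSet
  have hS : g ⁻¹' (g '' approxRepresentations B A ℓ) = approxRepresentations B A ℓ := by
    refine Set.Subset.antisymm ?_ (Set.subset_preimage_image _ _)
    rintro w ⟨v, hv, hvw⟩
    have hmem : -v + w ∈ H := QuotientAddGroup.eq.1 hvw
    have := add_mem_approxRepresentations hπ hA hv hmem
    rwa [add_neg_cancel_left] at this
  obtain ⟨h1, h2⟩ := measure_preimage_eq dv hkm hsurj (g '' approxRepresentations B A ℓ)
  rw [hS] at h1 h2
  refine ⟨h1, ?_⟩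
  -- Finiteness is needed since the natural-number cardinality of an infinite set is `0`.
  have hfin : (g '' approxRepresentations B A ℓ).Finite := by
    have := finite_map_box hπ matCoord_surjective hle ℓ
    refine Set.Finite.subset (Set.toFinite (((box π (matCoord u π m n)
      (fun _ => (ℓ : ℤ) - ℓ)).map g : AddSubgroup _) : Set _)) ?_
    rintro _ ⟨v, hv, rfl⟩
    refine ⟨v, ?_, rfl⟩
    have hv1 := hv.1
    rw [integralMatrices_eq_box] at hv1
    simp only [sub_self]
    exact hv1
  have hK0 : dv (box π (matCoord u π m n) 0 : Set (Matrix (Fin m) (Fin n) (Quat u π))) = 1 := by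
    rw [← integralMatrices_eq_box, hdv]
  have hmeas := measureReal_box dv hπ (matCoord_surjective (u := u) (m := m) (n := n))
    (fun a => (isOpen_box_matCoord hπ a).measurableSet) hK0 (fun _ => (ℓ : ℤ))
  have hkr : (dv (g.ker : Set (Matrix (Fin m) (Fin n) (Quat u π)))).toReal
      = (residueCard k : ℝ) ^ (-∑ _i : (Fin m × Fin n) × Fin 4, (ℓ : ℤ)) := by
    rw [hker, hH, hbox]
    exact hmeas
  rw [Measure.real, h2, ENNReal.toReal_mul, hkr, mul_comm, repCount_eq_card, ← hH,
    ← hg, ← hfin.cast_ncard_eq]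
  congr 1
  congr 2
  simp only [Finset.sum_const, Finset.card_univ, Fintype.card_prod, Fintype.card_fin, nsmul_eq_mul]
  push_cast
  ring

/-- The rows of `r C` modulo the integral vectors, for hermitian matrices `C`. -/
def hermRowsMod (u π : 𝒪[k]) (n : ℕ) (r : k) : Herm u π n →+ (Fin n → TorsionVectors u π n) where
  toFun C := rowsMod u π n n (r • C.1)
  map_zero' := by simp
  map_add' C D := by simp

omit [IsNonarchimedeanLocalField k] in
theorem measure_box_hermCoord_zero (h2 : (2 : k) ≠ 0) (dx : Measure (Herm u π n))
    (hdx : dx (integralHerm u π n) = 1) :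
    dx (box π (hermCoord u π n) 0 : Set (Herm u π n)) = 1 := by
  rw [← hdx]
  congr 1
  ext X
  have := mem_box_hermCoord (a := 0) (X := X) h2
  rw [neg_zero, zpow_zero, one_smul] at this
  exact this

/-- The bound depends only on the rows of `π ^ a C` modulo integral vectors, and the kernel of `C ↦`
these rows is a compact open lattice. The integral is therefore at most its volume times the sum
over all tuples. -/
theorem integrable_fourierIntegrand_gaussSum (hu : ¬ IsSquare (IsLocalRing.residue 𝒪[k] u))
    (hπ : Irreducible π) {ψ : AddChar k Circle} (hψ : HasConductorIntegers ψ) (hmn : 6 * n ≤ m)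
    (dv : Measure (Matrix (Fin m) (Fin n) (Quat u π))) [dv.IsAddHaarMeasure]
    (hdv : dv (integralMatrices u π m n) = 1) (dx : Measure (Herm u π n)) [dx.IsAddHaarMeasure]
    (A : Herm u π m) (hA : A ∈ nondegHerm u π m) (T : Herm u π n) :
    Integrable (fourierIntegrand ψ (gaussSum ψ dv A) T) dx := by
  have h2 := two_ne_zero_of_isUnit (isUnit_two_of_residue_not_isSquare hu)
  have h0 := prime_coe_ne_zero hπ
  refine ⟨Continuous.aestronglyMeasurable ?_, ?_⟩
  · refine (continuous_gaussSum hu hπ hψ dv A).mul (Continuous.comp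
      (by fun_prop : Continuous fun z : Circle => (z : ℂ)) (hψ.continuous.comp (Continuous.neg ?_)))
    simp only [pairing_eq_reTrace h2 (conjTranspose_eq _) (conjTranspose_eq T)]
    exact continuous_re.comp (Continuous.matrix_trace
      (continuous_subtype_val.matrix_mul continuous_const))
  · obtain ⟨a, ha⟩ := exists_enorm_gaussSum_le hu hπ hψ hmn dv hdv A hA
    have := countable_torsionVectors (u := u) (n := n) hπ
    set g := hermRowsMod u π n ((π : k) ^ a) with hg
    have hker : g.ker = box π (hermCoord u π n) (fun _ => (-a : ℤ)) := by
      ext C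
      rw [mem_box_hermCoord h2, neg_neg, zpow_natCast]
      exact rowsMod_eq_zero
    have hkm : MeasurableSet (g.ker : Set (Herm u π n)) := by
      rw [hker]; exact (isOpen_box_hermCoord _).measurableSet
    have hkf : dx (g.ker : Set (Herm u π n)) < ⊤ := by
      rw [hker]; exact (isCompact_box_hermCoord h2 hπ _).measure_lt_top
    calc ∫⁻ C, ‖fourierIntegrand ψ (gaussSum ψ dv A) T C‖ₑ ∂dx
        ≤ ∫⁻ C, (fun y => invCard (Submodule.span (integers u π) (Set.range y)) ^ (3 * n))
            (g C) ∂dx := by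
          refine lintegral_mono fun C => ?_
          rw [fourierIntegrand, enorm_mul]
          have : ‖((ψ (-pairing C.1 T.1) : Circle) : ℂ)‖ₑ = 1 := by
            rw [← ofReal_norm, Circle.norm_coe, ENNReal.ofReal_one]
          rw [this, mul_one]
          exact ha C
      _ ≤ dx (g.ker : Set (Herm u π n)) * 2 ^ n := by
          refine (lintegral_comp_addMonoidHom_le dx hkm (fun y =>
            invCard (Submodule.span (integers u π) (Set.range y)) ^ (3 * n))).trans ?_
          gcongr
          exact tsum_invCard_torsionVectors_le hu hπ n
      _ < ⊤ := ENNReal.mul_lt_top hkf (by finiteness)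

end LocalField

/-! ### Truncated Fourier integrals and the local density. -/

section MainIdentity

variable {k : Type*} [Field k] [ValuativeRel k] {u π : 𝒪[k]} {m n : ℕ}

/-- The character `C ↦ ψ (Re tr (X C))` of the hermitian matrices. -/
noncomputable def hermChar (ψ : AddChar k Circle) (X : Matrix (Fin n) (Fin n) (Quat u π)) :
    AddChar (Herm u π n) Circle where
  toFun C := ψ (reTrace n (X * C.1))
  map_zero_eq_one' := by simp
  map_add_eq_mul' C D := by
    rw [AddSubgroup.coe_add, Matrix.mul_add, map_add, AddChar.map_add_eq_mul]

theorem exists_isDenominator [IsDiscreteValuationRing 𝒪[k]] (hπ : Irreducible π)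
    (B : Matrix (Fin n) (Fin n) (Quat u π)) (A : Matrix (Fin m) (Fin m) (Quat u π)) :
    ∃ e, IsDenominator B A e := by
  obtain ⟨a, ha⟩ := exists_pow_smul_mem_integralMatrices hπ A
  obtain ⟨b, hb⟩ := exists_pow_smul_mem_integralMatrices hπ B
  refine ⟨a + b, ?_, ?_⟩
  · rw [pow_add, mul_comm, mul_smul]
    exact smul_mem_integralMatrices (pow_mem π.2 b) ha
  · rw [pow_add, mul_smul]
    exact smul_mem_integralMatrices (pow_mem π.2 a) hb

theorem mem_approxRepresentations_iff (h2 : (2 : k) ≠ 0) (hπ : Irreducible π)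
    {A : Matrix (Fin m) (Fin m) (Quat u π)} {B : Matrix (Fin n) (Fin n) (Quat u π)}
    {v : Matrix (Fin m) (Fin n) (Quat u π)} (hv : v ∈ integralMatrices u π m n)
    (X : Herm u π n) (hX : X.1 = vᴴ * A * v - B) (e ℓ : ℕ) :
    v ∈ approxRepresentations ((π : k) ^ e • B) ((π : k) ^ e • A) ℓ ↔
      X ∈ box π (hermCoord u π n) (fun _ => -((e : ℤ) - ℓ)) := by
  have h0 := prime_coe_ne_zero hπ
  rw [mem_box_hermCoord h2, hX]
  refine (and_iff_right hv).trans ?_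
  rw [mem_pow_smul_integralMatrices hπ, neg_neg, Matrix.mul_smul, Matrix.smul_mul, ← smul_sub,
    smul_smul, zpow_sub₀ h0, zpow_natCast, zpow_natCast, div_eq_inv_mul]

variable [TopologicalSpace k] [IsNonarchimedeanLocalField k]

/-- After Fubini, the inner integral over `C` is that of a character on a lattice: it is the volume
of the lattice when `v` is an approximate representation, and `0` otherwise. -/
theorem setIntegral_fourierIntegrand_gaussSum (hu : ¬ IsSquare (IsLocalRing.residue 𝒪[k] u))
    (hπ : Irreducible π) {ψ : AddChar k Circle} (hψ : HasConductorIntegers ψ)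
    (dv : Measure (Matrix (Fin m) (Fin n) (Quat u π))) [dv.IsAddHaarMeasure]
    (hdv : dv (integralMatrices u π m n) = 1) (dx : Measure (Herm u π n)) [dx.IsAddHaarMeasure]
    (hdx : dx (integralHerm u π n) = 1) (A : Herm u π m) (B : Herm u π n) {e : ℕ}
    (he : IsDenominator B.1 A.1 e) (ℓ : ℕ) :
    ∫ C in (box π (hermCoord u π n) (fun κ => (e : ℤ) - ℓ - pairingExponent n κ) :
        Set (Herm u π n)), fourierIntegrand ψ (gaussSum ψ dv A) B C ∂dx
      = (((residueCard k : ℝ) ^ (n * (n - 1)) *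
          (residueCard k : ℝ) ^ (-((e : ℤ) * n * (2 * n - 1))) *
          repRatio ((π : k) ^ e • B.1) ((π : k) ^ e • A.1) ℓ : ℝ) : ℂ) := by
  have h2u := isUnit_two_of_residue_not_isSquare hu
  have h2 := two_ne_zero_of_isUnit h2u
  have hq' : (residueCard k : ℝ) ≠ 0 := by
    have : residueCard k ≠ 0 := Nat.card_pos.ne'
    exact_mod_cast this
  set L := box π (hermCoord u π n) (fun κ => (e : ℤ) - ℓ - pairingExponent n κ) with hL
  set S := approxRepresentations ((π : k) ^ e • B.1) ((π : k) ^ e • A.1) ℓ with hS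
  have hLm : MeasurableSet (L : Set (Herm u π n)) := (isOpen_box_hermCoord _).measurableSet
  obtain ⟨hSm, hSv⟩ := measure_approxRepresentations hπ dv hdv ((π : k) ^ e • B.1) he.1 ℓ
  have hX : ∀ v : Matrix (Fin m) (Fin n) (Quat u π), vᴴ * A.1 * v - B.1 ∈ Herm u π n := fun v =>
    sub_mem (H := Herm u π n) (conjTranspose_mul_mul_eq A v) B.2
  have hpair : ∀ (v : Matrix (Fin m) (Fin n) (Quat u π)) (C : Herm u π n),
      pairing (vᴴ * A.1 * v - B.1) C.1 = reTrace n ((vᴴ * A.1 * v - B.1) * C.1) := fun v C =>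
    pairing_eq_reTrace h2 (conjTranspose_eq ⟨_, hX v⟩) (conjTranspose_eq C)
  have hcont : Continuous (Function.uncurry fun (C : Herm u π n)
      (v : Matrix (Fin m) (Fin n) (Quat u π)) =>
        (ψ (reTrace n ((vᴴ * A.1 * v - B.1) * C.1)) : ℂ)) := by
    refine Continuous.comp (by fun_prop : Continuous fun z : Circle => (z : ℂ))
      (hψ.continuous.comp (continuous_re.comp (Continuous.matrix_trace ?_)))
    fun_prop
  have hleft : ∀ C : Herm u π n, fourierIntegrand ψ (gaussSum ψ dv A) B C
      = ∫ v in (integralMatrices u π m n : Set (Matrix (Fin m) (Fin n) (Quat u π))),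
        (ψ (reTrace n ((vᴴ * A.1 * v - B.1) * C.1)) : ℂ) ∂dv := by
    intro C
    rw [fourierIntegrand, gaussSum_eq h2, ← integral_mul_const]
    congr 1
    ext v
    rw [pairing_eq_reTrace h2 (conjTranspose_eq C) (conjTranspose_eq B), ← Circle.coe_mul,
      ← AddChar.map_add_eq_mul, Matrix.sub_mul, map_sub, sub_eq_add_neg, reTrace_mul_comm C.1 B.1]
  have hinner : ∀ v ∈ (integralMatrices u π m n : Set (Matrix (Fin m) (Fin n) (Quat u π))),
      ∫ C in (L : Set (Herm u π n)), (ψ (reTrace n ((vᴴ * A.1 * v - B.1) * C.1)) : ℂ) ∂dx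
        = S.indicator (fun _ => (dx.real (L : Set (Herm u π n)) : ℂ)) v := by
    intro v hv
    have htriv := pairing_trivial_iff (isUnit_of_residue_not_isSquare hu) h2u hπ hψ
      (⟨_, hX v⟩ : Herm u π n) ((e : ℤ) - ℓ)
    rw [← mem_approxRepresentations_iff h2 hπ hv ⟨_, hX v⟩ rfl e ℓ] at htriv
    by_cases hvS : v ∈ S
    · rw [Set.indicator_of_mem hvS]
      refine setIntegral_addChar_of_trivial dx hLm (hermChar ψ (vᴴ * A.1 * v - B.1)) fun C hC => ?_
      have := htriv.2 hvS C hC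
      rwa [hpair v C] at this
    · rw [Set.indicator_of_notMem hvS]
      have hnt := mt htriv.1 hvS
      push Not at hnt
      obtain ⟨C, hC, hne⟩ := hnt
      rw [hpair v C] at hne
      exact setIntegral_addChar_of_nontrivial dx hLm (hermChar ψ (vᴴ * A.1 * v - B.1)) hC hne
  have := t2Space_quat (u := u) (π := π)
  rw [setIntegral_congr_fun hLm fun C _ => hleft C,
    setIntegral_swap_of_isCompact dx (isClopen_box_hermCoord _) isClopen_integralMatrices
      (isCompact_box_hermCoord h2 hπ _) isCompact_integralMatrices hcont,
    setIntegral_congr_fun isOpen_integralMatrices.measurableSet hinner,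
    setIntegral_indicator hSm, setIntegral_const,
    Set.inter_eq_self_of_subset_right (fun v hv => hv.1), hSv,
    measureReal_box dx hπ hermCoord_surjective (fun a => (isOpen_box_hermCoord a).measurableSet)
      (measure_box_hermCoord_zero h2 dx hdx), Complex.real_smul, ← Complex.ofReal_mul]
  congr 1
  -- The volume of the lattice is `q` to this exponent. Its part `ℓ n (2n - 1)` combines with the
  -- `-4ℓmn` from the measure of `v` to give the normalization of `repRatio`.
  have hsum : -∑ κ : HermIndex n, ((e : ℤ) - ℓ - pairingExponent n κ)
      = ((n * (n - 1) : ℕ) : ℤ) + (ℓ * (n * (2 * n - 1)) - e * n * (2 * n - 1)) := by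
    rw [Finset.sum_sub_distrib, Finset.sum_const, Finset.card_univ, nsmul_eq_mul, card_hermIndex,
      ← Nat.cast_sum, sum_pairingExponent]
    ring
  rw [hsum, repRatio, zpow_add₀ hq', zpow_sub₀ hq', zpow_neg, zpow_neg, zpow_natCast,
    show (ℓ : ℤ) * (4 * m * n) = ℓ * n * (4 * m - 2 * n + 1) + ℓ * (n * (2 * n - 1)) by ring,
    zpow_add₀ hq']
  field_simp

theorem tendsto_setIntegral_box (hπ : Irreducible π)
    {dx : Measure (Herm u π n)} {f : Herm u π n → ℂ} (hf : Integrable f dx) (e : ℤ)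
    (d : HermIndex n → ℕ) :
    Tendsto (fun ℓ : ℕ => ∫ C in (box π (hermCoord u π n) (fun κ => e - ℓ - d κ) :
      Set (Herm u π n)), f C ∂dx) atTop (𝓝 (∫ C, f C ∂dx)) := by
  have hunion : ⋃ ℓ : ℕ, (box π (hermCoord u π n) (fun κ => e - ℓ - d κ) : Set (Herm u π n))
      = Set.univ := by
    refine Set.eq_univ_of_forall fun C => Set.mem_iUnion.2 ?_
    obtain ⟨t, ht⟩ := exists_mem_box hπ (hermCoord u π n) (fun κ => e - d κ) C
    refine ⟨t, ?_⟩
    simp only [sub_right_comm e _ (t : ℤ)] at ht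
    exact ht
  have := tendsto_setIntegral_of_monotone (μ := dx) (f := f)
    (s := fun ℓ : ℕ => (box π (hermCoord u π n) (fun κ => e - ℓ - d κ) : Set (Herm u π n)))
    (fun ℓ => (isOpen_box_hermCoord _).measurableSet)
    (fun i j hij => box_mono hπ _ fun κ => by
      have : (i : ℤ) ≤ j := by exact_mod_cast hij
      simp only
      omega)
    (by rw [hunion]; exact hf.integrableOn)
  rwa [hunion, setIntegral_univ] at this

/-- For every common denominator the truncated identity expresses `repRatio` through integrals with
the same limit `F`; this yields both the existence of the limits and their scaling in `e`. -/
theorem tendsto_repRatio_and_fourierTransform_eq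
    (hu : ¬ IsSquare (IsLocalRing.residue 𝒪[k] u))
    (hπ : Irreducible π) {ψ : AddChar k Circle} (hψ : HasConductorIntegers ψ)
    (dv : Measure (Matrix (Fin m) (Fin n) (Quat u π))) [dv.IsAddHaarMeasure]
    (hdv : dv (integralMatrices u π m n) = 1) (dx : Measure (Herm u π n)) [dx.IsAddHaarMeasure]
    (hdx : dx (integralHerm u π n) = 1) (A : Herm u π m) (B : Herm u π n)
    (hint : Integrable (fourierIntegrand ψ (gaussSum ψ dv A) B) dx) :
    (∀ e : ℕ, IsDenominator B.1 A.1 e →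
      Tendsto (repRatio ((π : k) ^ e • B.1) ((π : k) ^ e • A.1)) atTop
        (𝓝 ((residueCard k : ℝ) ^ ((e : ℤ) * n * (2 * n - 1)) * localDensity B.1 A.1))) ∧
    fourierTransform ψ dx (gaussSum ψ dv A) B =
      (residueCard k : ℂ) ^ (n * (n - 1)) * (localDensity B.1 A.1 : ℂ) := by
  have h2 := two_ne_zero_of_isUnit (isUnit_two_of_residue_not_isSquare hu)
  have hqN : residueCard k ≠ 0 := Nat.card_pos.ne'
  have hq : (residueCard k : ℝ) ≠ 0 := Nat.cast_ne_zero.2 hqN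
  set F := fourierTransform ψ dx (gaussSum ψ dv A) B with hF
  set q := (residueCard k : ℝ) with hqdef
  have hconv : ∀ e : ℕ, IsDenominator B.1 A.1 e → Tendsto (fun ℓ : ℕ =>
      ((q ^ (n * (n - 1)) * q ^ (-((e : ℤ) * n * (2 * n - 1))) *
        repRatio ((π : k) ^ e • B.1) ((π : k) ^ e • A.1) ℓ : ℝ) : ℂ)) atTop (𝓝 F) := by
    intro e he
    simp_rw [hqdef, ← setIntegral_fourierIntegrand_gaussSum hu hπ hψ dv hdv dx hdx A B he]
    exact tendsto_setIntegral_box hπ hint e (pairingExponent n)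
  have hlim : ∀ e : ℕ, IsDenominator B.1 A.1 e →
      Tendsto (repRatio ((π : k) ^ e • B.1) ((π : k) ^ e • A.1)) atTop
        (𝓝 (q ^ ((e : ℤ) * n * (2 * n - 1)) * ((q ^ (n * (n - 1)))⁻¹ * F.re))) := by
    intro e he
    have h := (Complex.continuous_re.tendsto F).comp (hconv e he)
    have h' := h.const_mul (q ^ ((e : ℤ) * n * (2 * n - 1)) * (q ^ (n * (n - 1)))⁻¹)
    rw [mul_assoc _ _ F.re] at h'
    refine h'.congr fun ℓ => ?_
    rw [Function.comp_apply, Complex.ofReal_re, zpow_neg]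
    field_simp
  obtain ⟨e₀, he₀⟩ := exists_isDenominator hπ B.1 A.1
  -- The set of denominators is nonempty, so its infimum is attained and is not the default value
  -- `0` of the empty set.
  have hmin : IsDenominator B.1 A.1 (sInf {e | IsDenominator B.1 A.1 e}) :=
    Nat.sInf_mem (s := {e | IsDenominator B.1 A.1 e}) ⟨e₀, he₀⟩
  have hdens : localDensity B.1 A.1 = (q ^ (n * (n - 1)))⁻¹ * F.re := by
    rw [localDensity, (hlim _ hmin).limUnder_eq, ← hqdef, zpow_neg]
    field_simp
  -- `F` is a limit of real numbers.
  have hre : F = (F.re : ℂ) := by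
    have h := (Complex.continuous_re.tendsto F).comp (hconv e₀ he₀)
    exact tendsto_nhds_unique (hconv e₀ he₀) ((Complex.continuous_ofReal.tendsto F.re).comp h)
  refine ⟨fun e he => hdens ▸ hlim e he, ?_⟩
  have hqc : (residueCard k : ℂ) ≠ 0 := Nat.cast_ne_zero.2 hqN
  rw [hdens, hre, Complex.ofReal_re, hqdef]
  push_cast
  field_simp

end MainIdentity

end QuatHerm

theorem proposition2p4 {k : Type*} [Field k] [ValuativeRel k] [TopologicalSpace k]
    [IsNonarchimedeanLocalField k] (hq : Odd (QuatHerm.residueCard k))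
    (u π : 𝒪[k]) (hu : ¬ IsSquare (IsLocalRing.residue 𝒪[k] u)) (hπ : Irreducible π)
    (ψ : AddChar k Circle) (hψ : QuatHerm.HasConductorIntegers ψ)
    (m n : ℕ) (hmn : (8 : ℤ) * n - 1 ≤ m)
    (dv : Measure (Matrix (Fin m) (Fin n) (QuatHerm.Quat u π))) [dv.IsAddHaarMeasure]
    (hdv : dv (QuatHerm.integralMatrices u π m n) = 1)
    (dx : Measure (QuatHerm.Herm u π n)) [dx.IsAddHaarMeasure]
    (hdx : dx (QuatHerm.integralHerm u π n) = 1)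
    (A : QuatHerm.Herm u π m) (hA : A ∈ QuatHerm.nondegHerm u π m) :
    (∀ T : QuatHerm.Herm u π n,
      Integrable (QuatHerm.fourierIntegrand ψ (QuatHerm.gaussSum ψ dv A) T) dx) ∧
    (∀ B : QuatHerm.Herm u π n, B ∈ QuatHerm.nondegHerm u π n →
      (∀ e : ℕ, QuatHerm.IsDenominator B.1 A.1 e →
        Tendsto (QuatHerm.repRatio ((π : k) ^ e • B.1) ((π : k) ^ e • A.1)) atTop
          (𝓝 ((QuatHerm.residueCard k : ℝ) ^ ((e : ℤ) * n * (2 * n - 1)) *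
            QuatHerm.localDensity B.1 A.1))) ∧
      QuatHerm.fourierTransform ψ dx (QuatHerm.gaussSum ψ dv A) B =
        (QuatHerm.residueCard k : ℂ) ^ (n * (n - 1)) * (QuatHerm.localDensity B.1 A.1 : ℂ)) := by
  -- The required `6n ≤ m` follows from `8n - 1 ≤ m`, trivially when `n = 0`.
  have hint := QuatHerm.integrable_fourierIntegrand_gaussSum hu hπ hψ (by omega) dv hdv dx A hA
  exact ⟨hint, fun B _ => QuatHerm.tendsto_repRatio_and_fourierTransform_eq hu hπ hψ dv hdv dx hdx
    A B (hint B)⟩
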